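/- Let $V$ be the universe of sets, where classes are arbitrary (not necessarily definable) collections of sets. For a class $W$ and a set $\delta\in W$ that is a limit ordinal, call $S\subseteq\delta$ stationary in $W$ if it meets every closed unbounded subset of $\delta$ that belongs to $W$ (so if $\delta$ has cofinality $\omega$ in a model $W$ of ZFC, this means that $S$ contains a final segment of $\delta$). A transitive class $W$ is stationary correct at $\delta$ if every $S\in W$ that is a stationary subset of $\delta$ in $W$ is also stationary in $V$. A map $j:M\to N$ between transitive proper class models of ZFC is an elementary embedding if it is $\Delta_0$-elementary (it preserves the truth of all $\Delta_0$ formulas in both directions) and cofinal (for every $y\in N$ there is $x\in M$ with $y\in j(x)$); by a theorem of Gaifman such a map preserves all formulas. It is trivial if $M=N$ and $j$ is the identity, and nontrivial otherwise. **Theorem.** Suppose that $M$ and $N$ are transitive proper classes that are models of ZFC, that $M$ is stationary correct at all sufficiently large regular cardinals of $M$, and that $N$ is stationary correct at all sufficiently large regular cardinals of $N$ (each class satisfies this for all its regular cardinals above some ordinal $\theta$). Then there is no nontrivial elementary embedding $j:M\to N$ (where $j$ may be an arbitrary class function). -/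

import Mathlib

universe u

namespace InnerModel

/-! ### First-order set theory -/

/-- The symbols of the language of set theory: one binary relation symbol. -/
inductive MemRel : ℕ → Type
  | mem : MemRel 2

/-- The first-order language of set theory, with the single nonlogical symbol `∈`. -/
def setLang : FirstOrder.Language.{0, 0} := ⟨fun _ => Empty, MemRel⟩

/-- Every type with a membership relation is a structure for the language of set theory. -/
instance setStructure (α : Type*) [Membership α α] : setLang.Structure α where
  funMap f _ := f.elim
  RelMap {_} R xs := match R, xs with
    | .mem, xs => xs 0 ∈ xs 1

/-- The atomic formula `s ∈ t`. -/
def memFormula {α : Type*} {n : ℕ} (s t : setLang.Term (α ⊕ Fin n)) :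
    setLang.BoundedFormula α n :=
  FirstOrder.Language.Relations.boundedFormula₂ (L := setLang) MemRel.mem s t

/-- The `Δ₀` formulas: built from atomic formulas by propositional connectives (`⊥` and `→` generate
the others) and bounded quantifiers `∀ x ∈ t` (so `∃ x ∈ t` is `¬ ∀ x ∈ t, ¬`). In the bounded
quantifier, `n` is the new variable and `t` is a term in the old variables. -/
inductive IsDelta0 {α : Type*} : ∀ {n : ℕ}, setLang.BoundedFormula α n → Prop
  | falsum {n : ℕ} : IsDelta0 (FirstOrder.Language.BoundedFormula.falsum (n := n))
  | equal {n : ℕ} (s t : setLang.Term (α ⊕ Fin n)) :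
      IsDelta0 (FirstOrder.Language.BoundedFormula.equal s t)
  | mem {n : ℕ} (s t : setLang.Term (α ⊕ Fin n)) : IsDelta0 (memFormula s t)
  | imp {n : ℕ} {φ ψ : setLang.BoundedFormula α n} :
      IsDelta0 φ → IsDelta0 ψ → IsDelta0 (FirstOrder.Language.BoundedFormula.imp φ ψ)
  | ball {n : ℕ} (t : setLang.Term (α ⊕ Fin n)) {φ : setLang.BoundedFormula α (n + 1)} :
      IsDelta0 φ →
      IsDelta0 (FirstOrder.Language.BoundedFormula.all (FirstOrder.Language.BoundedFormula.imp
        (memFormula (FirstOrder.Language.Term.var (Sum.inr (Fin.last n)))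
          (t.relabel (Sum.map id Fin.castSucc))) φ))

/-- The structure `(α, ∈)` satisfies the axioms of ZFC. The instances of the two schemes are given
by all relations that are first-order definable with parameters over `(α, ∈)`. -/
structure ModelsZFC (α : Type*) [Membership α α] : Prop where
  extensionality : ∀ x y : α, (∀ z : α, z ∈ x ↔ z ∈ y) → x = y
  foundation : ∀ x : α, (∃ y : α, y ∈ x) → ∃ y : α, y ∈ x ∧ ∀ z : α, z ∈ x → z ∉ y
  pairing : ∀ x y : α, ∃ p : α, ∀ z : α, z ∈ p ↔ z = x ∨ z = y
  union : ∀ x : α, ∃ v : α, ∀ z : α, z ∈ v ↔ ∃ y : α, y ∈ x ∧ z ∈ y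
  powerset : ∀ x : α, ∃ p : α, ∀ z : α, z ∈ p ↔ ∀ w : α, w ∈ z → w ∈ x
  infinity : ∃ x : α, (∃ e : α, e ∈ x ∧ ∀ z : α, z ∉ e) ∧
    ∀ y : α, y ∈ x → ∃ s : α, s ∈ x ∧ ∀ z : α, z ∈ s ↔ z ∈ y ∨ z = y
  separation : ∀ D : Set α, (Set.univ : Set α).Definable₁ setLang D →
    ∀ x : α, ∃ y : α, ∀ z : α, z ∈ y ↔ z ∈ x ∧ z ∈ D
  replacement : ∀ F : Set (α × α), (Set.univ : Set α).Definable₂ setLang F →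
    ∀ x : α, (∀ z : α, z ∈ x → ∃! w : α, (z, w) ∈ F) →
      ∃ y : α, ∀ w : α, w ∈ y ↔ ∃ z : α, z ∈ x ∧ (z, w) ∈ F
  /-- Every family of pairwise disjoint nonempty sets has a transversal. -/
  choice : ∀ x : α, (∀ y : α, y ∈ x → ∃ z : α, z ∈ y) →
    (∀ y y' : α, y ∈ x → y' ∈ x → (∃ z : α, z ∈ y ∧ z ∈ y') → y = y') →
      ∃ c : α, ∀ y : α, y ∈ x → ∃! z : α, z ∈ y ∧ z ∈ c

/-! ### Transitive class models

The universe `V` is `ZFSet`, and classes are arbitrary collections of sets (`Class`); `W x` says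
that the set `x` belongs to the class `W`. -/

/-- The collection of all elements of a class. -/
abbrev Elem (W : Class.{u}) : Type (u + 1) := {x : ZFSet.{u} // W x}

/-- A class is viewed as a structure with the true membership relation. -/
instance elemMembership (W : Class.{u}) : Membership (Elem W) (Elem W) where
  mem y x := x.val ∈ y.val

/-- A transitive proper class which is a model of ZFC. -/
structure IsTransitiveModel (W : Class.{u}) : Prop where
  transitive : ∀ x y : ZFSet.{u}, x ∈ y → W y → W x
  proper : W ∉ Class.univ.{u}
  modelsZFC : ModelsZFC (Elem W)

/-! ### Elementary embeddings -/

/-- A `Δ₀`-elementary cofinal embedding. -/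
structure IsElementary {M N : Class.{u}} (j : Elem M → Elem N) : Prop where
  delta0 : ∀ (n : ℕ) (φ : setLang.Formula (Fin n)), IsDelta0 φ → ∀ x : Fin n → Elem M,
    φ.Realize (j ∘ x) ↔ φ.Realize x
  cofinal : ∀ y : Elem N, ∃ x : Elem M, y ∈ j x

/-- `j : M → N` is trivial if `M = N` and `j` is the identity. -/
def IsTrivial {M N : Class.{u}} (j : Elem M → Elem N) : Prop :=
  M = N ∧ ∀ x : Elem M, (j x).val = x.val

/-! ### Stationary correctness -/

/-- `C` is a closed unbounded subset of the limit ordinal `δ`: it is an unbounded subset of `δ`, and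
contains every nonzero `γ ∈ δ` in which `C ∩ γ` is unbounded. All quantifiers are bounded, so that
this notion is absolute between transitive classes. -/
def IsClubIn (δ C : ZFSet.{u}) : Prop :=
  C ⊆ δ ∧ (∀ α ∈ δ, ∃ β ∈ C, α ∈ β) ∧
    ∀ γ ∈ δ, γ.Nonempty → (∀ α ∈ γ, ∃ β ∈ C, β ∈ γ ∧ α ∈ β) → γ ∈ C

/-- `S` is a stationary subset of the limit ordinal `δ` in the sense of the transitive class `W`:
it meets every club subset of `δ` that belongs to `W`. If `δ` has cofinality `ω` in a model `W` of
set theory, then this says exactly that `S` contains a final segment of `δ`, since otherwise some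
cofinal subset of `δ` of order type `ω` is a club disjoint from `S`. -/
def IsStationaryIn (W : Class.{u}) (δ S : ZFSet.{u}) : Prop :=
  S ⊆ δ ∧ ∀ C : ZFSet.{u}, W C → IsClubIn δ C → ∃ β ∈ S, β ∈ C

/-- `W` is stationary correct (to the universe) at `δ`: every subset of `δ` in `W` that is
stationary in `W` is stationary in the universe. -/
def StationaryCorrectAt (W : Class.{u}) (δ : ZFSet.{u}) : Prop :=
  ∀ S : ZFSet.{u}, W S → IsStationaryIn W δ S → IsStationaryIn Class.univ δ S

/-- `δ` is an infinite regular cardinal of the transitive class `W`: a limit ordinal in `W` such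
that no function in `W` from a smaller ordinal to `δ` is unbounded in `δ`. -/
def IsRegularIn (W : Class.{u}) (δ : ZFSet.{u}) : Prop :=
  W δ ∧ δ.IsOrdinal ∧ δ.Nonempty ∧ (∀ α ∈ δ, ∃ β ∈ δ, α ∈ β) ∧
    ∀ α ∈ δ, ∀ f : ZFSet.{u}, W f → ZFSet.IsFunc α δ f →
      ∃ γ ∈ δ, ∀ ξ ∈ α, ∀ β : ZFSet.{u}, ZFSet.pair ξ β ∈ f → β ∈ γ

/-- `W` is stationary correct at all sufficiently large regular cardinals of `W`. -/
def EventuallyStationaryCorrect (W : Class.{u}) : Prop :=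
  ∃ θ : Ordinal.{u}, ∀ δ : ZFSet.{u}, IsRegularIn W δ → θ.toZFSet ∈ δ → StationaryCorrectAt W δ

end InnerModel

/-! It suffices that every ordinal is a value of `j`. A strictly increasing map of the ordinals onto
themselves is the identity, and every set of `M` is enumerated in `M` by an ordinal, so an embedding
that fixes all ordinals is trivial (`isTrivial_of_ordMap_eq`).

Call a strictly increasing cofinal map from `τ` to `α` a ladder. Below a regular cardinal `ν` of a
model, the points with a ladder of fixed limit length `τ < ν` in the model are stationary in the
model. If the model is correct at `ν`, they are stationary in `V`, and therefore the true cofinality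
of `ν` exceeds every regular `μ < ν` (`lt_cof_of_stationaryCorrectAt`). Consequently an ordinal of
large regular cofinality `μ` has a ladder of length `μ` in the model (`hasLadder_of_cof_eq`), and no
regular cardinal of the model lies strictly between a large limit cardinal `l` of cofinality `ω` and
its successor `l⁺` (`not_isRegularIn`).

A closure point of `j` is fixed if it has in `M` a ladder whose length is fixed. This yields
arbitrarily large fixed limit cardinals `l` of cofinality `ω`, and then `l⁺` is fixed as well:
otherwise `l⁺` lies strictly between `l` and `j(l⁺)` and is singular in `N` by elementarity
(`ordMap_succ_eq`).

Given `κ`, take two such fixed successors `μ < ρ` with `κ < ρ`, and in `M` a system `c` of ladders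
of length `μ` for points below `ρ`. For some `ξ < μ`, the set `G` of all `γ` such that `{α | c_α(ξ)
= γ}` is stationary in `M` is unbounded in `ρ` (`exists_coordinate`). For `γ ∈ j(G)` the set `{α |
j(c)_α(j ξ) = γ}` is stationary in `N`, hence in `V`, so it contains a closure point `α` of `j`. Its
cofinality is `μ`, so it has a ladder in `M`; thus `j(α) = α`, `j(c)_α = j(c_α)` and `γ = j(c_α(ξ))`
(`exists_eq_ordMap`). So `j(G)` consists of values of `j`, and comparing the enumeration of `G` with
its image shows that `κ` is a value too (`exists_ordMap_eq`). -/

namespace InnerModel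

open FirstOrder FirstOrder.Language

/-! ### `Δ₀` relations -/

/-- Assignments of sets to free variables indexed by `α` and to `n` bound variables. -/
abbrev Ctx (α : Type) (n : ℕ) : Type (u + 1) := (α → ZFSet.{u}) × (Fin n → ZFSet.{u})

namespace Ctx

variable {α : Type} {n : ℕ}

/-- Forget the last bound variable. -/
def pop (c : Ctx.{u} α (n + 1)) : Ctx.{u} α n := (c.1, fun i => c.2 i.castSucc)

/-- The value of the last bound variable. -/
def top (c : Ctx.{u} α (n + 1)) : ZFSet.{u} := c.2 (Fin.last n)

end Ctx

/-- Functions on assignments which return the value of some variable. -/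
def IsVar {α : Type} {n : ℕ} (p : Ctx.{u} α n → ZFSet.{u}) : Prop :=
  ∃ i : α ⊕ Fin n, ∀ c, p c = Sum.elim c.1 c.2 i

/-- Relations on assignments which are expressed by a `Δ₀` formula. -/
def D0 {α : Type} {n : ℕ} (R : Ctx.{u} α n → Prop) : Prop :=
  ∃ φ : setLang.BoundedFormula α n, IsDelta0 φ ∧ ∀ c, φ.Realize c.1 c.2 ↔ R c

theorem realize_memFormula {β : Type*} [Membership β β] {α : Type*} {n : ℕ}
    (s t : setLang.Term (α ⊕ Fin n)) (v : α → β) (xs : Fin n → β) :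
    (memFormula s t).Realize v xs ↔
      s.realize (Sum.elim v xs) ∈ t.realize (Sum.elim v xs) := by
  exact BoundedFormula.realize_rel₂ (M := β) (R := (MemRel.mem : setLang.Relations 2))
    (t₁ := s) (t₂ := t)

/-- The language has no function symbols, so every term is a variable. -/
theorem realize_term {W : Class.{u}} {β : Type*} (t : setLang.Term β) (v : β → Elem W) :
    (t.realize v).val = t.realize (fun i => (v i).val) := by
  cases t with
  | var i => rfl
  | func f _ => exact f.elim

theorem realize_ball {β : Type*} [Membership β β] {α : Type*} {n : ℕ}
    (t : setLang.Term (α ⊕ Fin n)) (φ : setLang.BoundedFormula α (n + 1))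
    (v : α → β) (xs : Fin n → β) :
    (BoundedFormula.all (BoundedFormula.imp (memFormula (Term.var (Sum.inr (Fin.last n)))
          (t.relabel (Sum.map id Fin.castSucc))) φ)).Realize v xs ↔
      ∀ z : β, z ∈ t.realize (Sum.elim v xs) → φ.Realize v (Fin.snoc xs z) := by
  rw [BoundedFormula.realize_all]
  refine forall_congr' fun z => ?_
  rw [BoundedFormula.realize_imp, realize_memFormula]
  have : (t.relabel (Sum.map id Fin.castSucc)).realize (Sum.elim v (Fin.snoc xs z : Fin (n+1) → β))
      = t.realize (Sum.elim v xs) := by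
    rw [Term.realize_relabel]
    congr 1
    funext i
    rcases i with i | i <;> simp
  rw [this]
  simp

/-- `Δ₀` formulas are absolute for transitive classes. -/
theorem IsDelta0.realize_iff {W : Class.{u}} (hW : ∀ x y : ZFSet.{u}, x ∈ y → W y → W x)
    {α : Type*} {n : ℕ} {φ : setLang.BoundedFormula α n} (h : IsDelta0 φ)
    (v : α → Elem W) (xs : Fin n → Elem W) :
    φ.Realize v xs ↔ φ.Realize (fun i => (v i).val) (fun i => (xs i).val) := by
  have hs : ∀ {n : ℕ} (xs : Fin n → Elem W), (fun i => (Sum.elim v xs i).val) =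
      Sum.elim (fun i => (v i).val) (fun i => (xs i).val) := by
    intro n xs
    funext i
    cases i <;> rfl
  induction h with
  | falsum => exact Iff.rfl
  | equal s t =>
    refine Subtype.val_inj.symm.trans ?_
    rw [realize_term, realize_term, hs]
    rfl
  | mem s t =>
    rw [realize_memFormula, realize_memFormula, ← hs, ← realize_term, ← realize_term]
    rfl
  | imp _ _ h1 h2 =>
    exact imp_congr (h1 _) (h2 _)
  | ball t _ ih =>
    rw [realize_ball, realize_ball]
    have hsn : ∀ {n : ℕ} (xs : Fin n → Elem W) (z : Elem W),
        (fun i => ((Fin.snoc xs z : Fin (n + 1) → Elem W) i).val) =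
          Fin.snoc (fun i => (xs i).val) z.val := by
      intro n xs z
      funext i
      refine Fin.lastCases ?_ (fun i => ?_) i <;> simp
    constructor
    · intro H z hz
      rw [← hs, ← realize_term] at hz
      have := (ih (Fin.snoc xs ⟨z, hW _ _ hz (Subtype.prop _)⟩)).1 (H _ hz)
      rwa [hsn] at this
    · intro H z hz
      refine (ih _).2 ?_
      rw [hsn]
      refine H _ ?_
      rw [← hs, ← realize_term]
      exact hz

namespace IsVar

variable {α : Type} {n : ℕ}

theorem fv (i : α) : IsVar (n := n) fun c : Ctx.{u} α n => c.1 i := ⟨Sum.inl i, fun _ => rfl⟩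

theorem top : IsVar fun c : Ctx.{u} α (n + 1) => c.top := ⟨Sum.inr (Fin.last n), fun _ => rfl⟩

theorem pop {p : Ctx.{u} α n → ZFSet.{u}} (h : IsVar p) : IsVar fun c => p c.pop := by
  obtain ⟨i, hi⟩ := h
  refine ⟨Sum.map id Fin.castSucc i, fun c => (hi _).trans ?_⟩
  cases i <;> rfl

end IsVar

namespace D0

variable {α : Type} {n : ℕ} {p q r s t : Ctx.{u} α n → ZFSet.{u}} {A B : Ctx.{u} α n → Prop}

theorem mem (hp : IsVar p) (hq : IsVar q) : D0 fun c => p c ∈ q c := by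
  obtain ⟨i, hi⟩ := hp
  obtain ⟨k, hk⟩ := hq
  refine ⟨_, .mem (.var i) (.var k), fun c => ?_⟩
  rw [realize_memFormula]
  beta_reduce
  rw [hi, hk]
  rfl

theorem eq (hp : IsVar p) (hq : IsVar q) : D0 fun c => p c = q c := by
  obtain ⟨i, hi⟩ := hp
  obtain ⟨k, hk⟩ := hq
  refine ⟨_, .equal (.var i) (.var k), fun c => ?_⟩
  beta_reduce
  rw [hi, hk]
  rfl

theorem imp (hA : D0 A) (hB : D0 B) : D0 fun c => A c → B c := by
  obtain ⟨φ, hφ, h1⟩ := hA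
  obtain ⟨ψ, hψ, h2⟩ := hB
  refine ⟨_, .imp hφ hψ, fun c => ?_⟩
  rw [BoundedFormula.realize_imp, h1, h2]

theorem not (hA : D0 A) : D0 fun c => ¬ A c := by
  obtain ⟨φ, hφ, h1⟩ := hA
  refine ⟨_, .imp hφ .falsum, fun c => ?_⟩
  rw [BoundedFormula.realize_imp, h1]
  rfl

theorem congr (hA : D0 A) (h : ∀ c, A c ↔ B c) : D0 B := by
  obtain ⟨φ, hφ, h1⟩ := hA
  exact ⟨φ, hφ, fun c => (h1 c).trans (h c)⟩

theorem and (hA : D0 A) (hB : D0 B) : D0 fun c => A c ∧ B c :=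
  (hA.imp hB.not).not.congr fun c => by tauto

theorem or (hA : D0 A) (hB : D0 B) : D0 fun c => A c ∨ B c :=
  (hA.not.imp hB).congr fun c => by tauto

theorem iff (hA : D0 A) (hB : D0 B) : D0 fun c => A c ↔ B c :=
  ((hA.imp hB).and (hB.imp hA)).congr fun c => by tauto

theorem ball {R : Ctx.{u} α n → ZFSet.{u} → Prop} (hp : IsVar p)
    (hR : D0 fun c : Ctx.{u} α (n + 1) => R c.pop c.top) : D0 fun c => ∀ z ∈ p c, R c z := by
  obtain ⟨i, hi⟩ := hp
  obtain ⟨φ, hφ, h1⟩ := hR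
  refine ⟨_, .ball (.var i) hφ, fun c => ?_⟩
  rw [realize_ball]
  beta_reduce
  rw [hi]
  refine forall_congr' fun z => imp_congr Iff.rfl ?_
  refine (h1 (c.1, Fin.snoc c.2 z)).trans ?_
  simp [Ctx.pop, Ctx.top]

theorem bex {R : Ctx.{u} α n → ZFSet.{u} → Prop} (hp : IsVar p)
    (hR : D0 fun c : Ctx.{u} α (n + 1) => R c.pop c.top) : D0 fun c => ∃ z ∈ p c, R c z :=
  (D0.ball (R := fun c z => ¬ R c z) hp hR.not).not.congr fun c => by simp

theorem subset (hp : IsVar p) (hq : IsVar q) : D0 fun c => p c ⊆ q c :=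
  .ball hp (.mem .top hq.pop)

theorem nonempty (hp : IsVar p) : D0 fun c => (p c).Nonempty :=
  (D0.bex (R := fun c z => z = z) hp (.eq .top .top)).congr fun c => by
    simp [ZFSet.nonempty_def]

/-- `r = {p, q}` -/
theorem eq_upair (hr : IsVar r) (hp : IsVar p) (hq : IsVar q) :
    D0 fun c => r c = {p c, q c} :=
  (((D0.mem hp hr).and (.mem hq hr)).and
    (.ball hr ((D0.eq .top hp.pop).or (.eq .top hq.pop)))).congr fun c => by
    constructor
    · rintro ⟨⟨h1, h2⟩, h3⟩
      ext z
      simp only [ZFSet.mem_pair]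
      refine ⟨h3 z, ?_⟩
      rintro (rfl | rfl) <;> assumption
    · intro h
      simp [h]

/-- `r = (p, q)` -/
theorem eq_pair (hr : IsVar r) (hp : IsVar p) (hq : IsVar q) :
    D0 fun c => r c = ZFSet.pair (p c) (q c) := by
  have : D0 fun c => ((∃ z ∈ r c, z = {p c, p c}) ∧ (∃ z ∈ r c, z = {p c, q c})) ∧
      ∀ z ∈ r c, z = {p c, p c} ∨ z = {p c, q c} :=
    ((D0.bex hr (.eq_upair .top hp.pop hp.pop)).and (.bex hr (.eq_upair .top hp.pop hq.pop))).and
      (.ball hr ((D0.eq_upair .top hp.pop hp.pop).or (.eq_upair .top hp.pop hq.pop)))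
  refine this.congr fun c => ?_
  simp only [ZFSet.pair, ZFSet.pair_eq_singleton]
  constructor
  · rintro ⟨⟨⟨_, h1, rfl⟩, ⟨_, h2, rfl⟩⟩, h3⟩
    ext z
    simp only [ZFSet.mem_pair]
    refine ⟨h3 z, ?_⟩
    rintro (rfl | rfl) <;> assumption
  · intro h
    simp [h]

/-- `(p, q) ∈ r` -/
theorem pair_mem (hp : IsVar p) (hq : IsVar q) (hr : IsVar r) :
    D0 fun c => ZFSet.pair (p c) (q c) ∈ r c := by
  have : D0 fun c => ∃ z ∈ r c, z = ZFSet.pair (p c) (q c) :=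
    .bex hr (.eq_pair .top hp.pop hq.pop)
  exact this.congr fun c => by simp

end D0

/-! ### Closure properties of transitive models -/

/-- The powerset of `x` as computed in `W`. -/
noncomputable def pw (W : Class.{u}) (x : ZFSet.{u}) : ZFSet.{u} :=
  ZFSet.sep (fun z => W z) (ZFSet.powerset x)

theorem mem_pw {W : Class.{u}} {x z : ZFSet.{u}} : z ∈ pw W x ↔ W z ∧ z ⊆ x := by
  simp [pw, and_comm]

namespace IsTransitiveModel

variable {W : Class.{u}}

/-- By absoluteness a `Δ₀` relation evaluated in `V` agrees on `W` with its formula evaluated in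
`W`, so it is definable over `W` from the parameters `v`. -/
theorem sep (hW : IsTransitiveModel W) {k : ℕ} (v : Fin k → Elem W) {R : Ctx.{u} (Fin k) 1 → Prop} (hR : D0 R)
    {x : ZFSet.{u}} (hx : W x) :
    W (ZFSet.sep (fun z => R (fun i => (v i).val, fun _ => z)) x) := by
  obtain ⟨φ, hφ, h1⟩ := hR
  have hdef : (Set.univ : Set (Elem W)).Definable₁ setLang
      {z : Elem W | R (fun i => (v i).val, fun _ => z.val)} := by
    refine Set.definable_iff_exists_formula_sum.2
      ⟨φ.toFormula.relabel (Sum.map (fun i => ⟨v i, trivial⟩) id), ?_⟩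
    ext y
    rw [Set.mem_ofPred_eq, Set.mem_ofPred_eq, Set.mem_ofPred_eq, Formula.realize_relabel,
      BoundedFormula.realize_toFormula, hφ.realize_iff hW.transitive]
    refine (h1 _).symm.trans (iff_of_eq ?_)
    congr 1
    funext i
    have : i = 0 := Subsingleton.elim _ _
    subst this
    rfl
  obtain ⟨y, hy⟩ := hW.modelsZFC.separation _ hdef ⟨x, hx⟩
  convert y.2
  ext z
  rw [ZFSet.mem_sep]
  constructor
  · rintro ⟨h1, h2⟩
    exact (hy ⟨z, hW.transitive _ _ h1 hx⟩).2 ⟨h1, h2⟩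
  · intro h
    exact (hy ⟨z, hW.transitive _ _ h y.2⟩).1 h

theorem pair_set (hW : IsTransitiveModel W) {x y : ZFSet.{u}} (hx : W x) (hy : W y) : W {x, y} := by
  obtain ⟨p, hp⟩ := hW.modelsZFC.pairing ⟨x, hx⟩ ⟨y, hy⟩
  convert p.2
  ext z
  rw [ZFSet.mem_pair]
  constructor
  · rintro (rfl | rfl)
    · exact (hp ⟨z, hx⟩).2 (Or.inl rfl)
    · exact (hp ⟨z, hy⟩).2 (Or.inr rfl)
  · intro h
    simpa [Subtype.ext_iff] using (hp ⟨z, hW.transitive _ _ h p.2⟩).1 h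

theorem singleton (hW : IsTransitiveModel W) {x : ZFSet.{u}} (hx : W x) : W {x} := by
  simpa using hW.pair_set hx hx

theorem pair (hW : IsTransitiveModel W) {x y : ZFSet.{u}} (hx : W x) (hy : W y) : W (ZFSet.pair x y) :=
  hW.pair_set (hW.singleton hx) (hW.pair_set hx hy)

theorem sUnion (hW : IsTransitiveModel W) {x : ZFSet.{u}} (hx : W x) : W (ZFSet.sUnion x) := by
  obtain ⟨p, hp⟩ := hW.modelsZFC.union ⟨x, hx⟩
  convert p.2
  ext z
  rw [ZFSet.mem_sUnion]
  constructor
  · rintro ⟨y, hy, hz⟩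
    have hWy := hW.transitive _ _ hy hx
    exact (hp ⟨z, hW.transitive _ _ hz hWy⟩).2 ⟨⟨y, hWy⟩, hy, hz⟩
  · intro h
    obtain ⟨y, hy, hz⟩ := (hp ⟨z, hW.transitive _ _ h p.2⟩).1 h
    exact ⟨y, hy, hz⟩

theorem union (hW : IsTransitiveModel W) {x y : ZFSet.{u}} (hx : W x) (hy : W y) : W (x ∪ y) := by
  have := hW.sUnion (hW.pair_set hx hy)
  convert this
  ext z
  simp

theorem insert_set (hW : IsTransitiveModel W) {x y : ZFSet.{u}} (hx : W x) (hy : W y) : W (Insert.insert x y) := by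
  have := hW.union (hW.singleton hx) hy
  convert this
  ext z
  simp

theorem pw (hW : IsTransitiveModel W) {x : ZFSet.{u}} (hx : W x) : W (pw W x) := by
  obtain ⟨p, hp⟩ := hW.modelsZFC.powerset ⟨x, hx⟩
  have key : ∀ z, W z → (z ∈ p.val ↔ z ⊆ x) := by
    intro z hz
    refine (hp ⟨z, hz⟩).trans ⟨fun h w hw => h ⟨w, hW.transitive _ _ hw hz⟩ hw,
      fun h w hw => h hw⟩
  convert p.2
  ext z
  rw [mem_pw]
  exact ⟨fun h => (key z h.1).2 h.2, fun h =>
    have := hW.transitive _ _ h p.2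
    ⟨this, (key z this).1 h⟩⟩

theorem choice (hW : IsTransitiveModel W) {x : ZFSet.{u}} (hx : W x) (hne : ∀ y ∈ x, ∃ z, z ∈ y)
    (hd : ∀ y ∈ x, ∀ y' ∈ x, ∀ z, z ∈ y → z ∈ y' → y = y') :
    ∃ c, W c ∧ ∀ y ∈ x, ∃! z, z ∈ y ∧ z ∈ c := by
  obtain ⟨c, hc⟩ := hW.modelsZFC.choice ⟨x, hx⟩
    (fun y hy => by
      obtain ⟨z, hz⟩ := hne _ hy
      exact ⟨⟨z, hW.transitive _ _ hz y.2⟩, hz⟩)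
    (fun y y' hy hy' ⟨z, hz, hz'⟩ => Subtype.ext (hd _ hy _ hy' _ hz hz'))
  refine ⟨c, c.2, fun y hy => ?_⟩
  obtain ⟨z, hz, hu⟩ := hc ⟨y, hW.transitive _ _ hy hx⟩ hy
  exact ⟨z, hz, fun w hw => congrArg Subtype.val (hu ⟨w, hW.transitive _ _ hw.2 c.2⟩ hw)⟩

/-- Replacement for relations of the form `∀ t, R z w t` with `R` a `Δ₀` relation. -/
theorem replacement (hW : IsTransitiveModel W) {R : Ctx.{u} (Fin 2) 1 → Prop} (hR : D0 R) {x : ZFSet.{u}} (hx : W x)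
    (hf : ∀ z ∈ x, ∃! w, W w ∧ ∀ t, W t → R (![z, w], fun _ => t)) :
    ∃ y, W y ∧ ∀ w, w ∈ y ↔ W w ∧ ∃ z ∈ x, ∀ t, W t → R (![z, w], fun _ => t) := by
  obtain ⟨φ, hφ, h1⟩ := hR
  have hdef : (Set.univ : Set (Elem W)).Definable₂ setLang
      {p : Elem W × Elem W | ∀ t, W t → R (![p.1.val, p.2.val], fun _ => t)} := by
    refine Set.Definable.mono (A := ∅) (Set.empty_definable_iff.2 ⟨φ.all, ?_⟩) (Set.empty_subset _)
    ext y
    rw [Set.mem_ofPred_eq, Set.mem_ofPred_eq, Set.mem_ofPred_eq, Formula.Realize,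
      BoundedFormula.realize_all]
    have : ∀ t : Elem W, φ.Realize y (Fin.snoc default t : Fin 1 → Elem W) ↔
        R (![(y 0).val, (y 1).val], fun _ => t.val) := by
      intro t
      rw [hφ.realize_iff hW.transitive]
      refine (h1 (fun i => (y i).val,
        fun i => ((Fin.snoc default t : Fin 1 → Elem W) i).val)).trans (iff_of_eq ?_)
      congr 1
      refine Prod.ext ?_ ?_
      · funext i
        fin_cases i <;> rfl
      · funext i
        have : i = 0 := Subsingleton.elim _ _
        subst this
        rfl
    exact ⟨fun h t => (this t).2 (h t t.2), fun h t ht => (this ⟨t, ht⟩).1 (h _)⟩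
  obtain ⟨y, hy⟩ := hW.modelsZFC.replacement _ hdef ⟨x, hx⟩ (by
    intro z hz
    obtain ⟨w, hw, hu⟩ := hf _ hz
    exact ⟨⟨w, hw.1⟩, hw.2, fun w' hw' => Subtype.ext (hu _ ⟨w'.2, hw'⟩)⟩)
  refine ⟨y, y.2, fun w => ?_⟩
  constructor
  · intro h
    have hw := hW.transitive _ _ h y.2
    obtain ⟨z, hz, h2⟩ := (hy ⟨w, hw⟩).1 h
    exact ⟨hw, z, hz, h2⟩
  · rintro ⟨hw, z, hz, h2⟩
    exact (hy ⟨w, hw⟩).2 ⟨⟨z, hW.transitive _ _ hz hx⟩, hz, h2⟩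

end IsTransitiveModel

namespace IsElementary

variable {M N : Class.{u}} {j : Elem M → Elem N}

/-- Absoluteness on both sides replaces evaluation in `M` and in `N` by evaluation in `V`, so that
elementarity applies to statements about actual sets. -/
theorem iff (hM : IsTransitiveModel M) (hN : IsTransitiveModel N) (hj : IsElementary j) {k : ℕ}
    {R : Ctx.{u} (Fin k) 0 → Prop} (hR : D0 R) (x : Fin k → Elem M) :
    R (fun i => (j (x i)).val, Fin.elim0) ↔ R (fun i => (x i).val, Fin.elim0) := by
  obtain ⟨φ, hφ, h1⟩ := hR
  have := hj.delta0 k φ hφ x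
  unfold Formula.Realize at this
  rw [hφ.realize_iff hM.transitive, hφ.realize_iff hN.transitive] at this
  rw [Subsingleton.elim (fun i => ((default : Fin 0 → Elem N) i).val) Fin.elim0,
    Subsingleton.elim (fun i => ((default : Fin 0 → Elem M) i).val) Fin.elim0] at this
  exact ((h1 _).symm.trans this).trans (h1 _)

end IsElementary

/-! ### The rank function and the ordinals of a transitive model -/

namespace D0

variable {α : Type} {n : ℕ} {p q r s t : Ctx.{u} α n → ZFSet.{u}} {A B : Ctx.{u} α n → Prop}

/-- Both coordinates of a Kuratowski pair are elements of its elements, so the quantifiers can be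
bounded. The five new variables are the pair, two of its elements and the two coordinates. -/
theorem forall_pair {R : Ctx.{u} α n → ZFSet.{u} → ZFSet.{u} → Prop} (hp : IsVar p)
    (hR : D0 fun c : Ctx.{u} α (n + 5) => R c.pop.pop.pop.pop.pop c.pop.top c.top) :
    D0 fun c => ∀ x y, ZFSet.pair x y ∈ p c → R c x y := by
  have : D0 fun c => ∀ e ∈ p c, ∀ a ∈ e, ∀ b ∈ e, ∀ x ∈ a, ∀ y ∈ b, e = ZFSet.pair x y →
      R c x y :=
    .ball hp <| .ball .top <| .ball IsVar.top.pop <| .ball IsVar.top.pop <| .ball IsVar.top.pop <|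
      (D0.eq_pair IsVar.top.pop.pop.pop.pop IsVar.top.pop IsVar.top).imp hR
  refine this.congr fun c => ⟨fun h x y hxy => ?_, fun h e he a _ b _ x _ y _ hxy =>
    h x y (hxy ▸ he)⟩
  exact h _ hxy {x} (by simp [ZFSet.pair]) {x, y} (by simp [ZFSet.pair]) x (by simp) y (by simp) rfl

theorem mem_dom (hp : IsVar p) (hq : IsVar q) :
    D0 fun c => ∃ y, ZFSet.pair (p c) y ∈ q c := by
  have : D0 fun c => ¬ ∀ x y, ZFSet.pair x y ∈ q c → x ≠ p c :=
    .not <| .forall_pair hq <| .not <| .eq IsVar.top.pop hp.pop.pop.pop.pop.pop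
  refine this.congr fun c => ?_
  push Not
  constructor
  · rintro ⟨x, y, h, rfl⟩
    exact ⟨y, h⟩
  · rintro ⟨y, h⟩
    exact ⟨_, y, h, rfl⟩

theorem isTransitive (hp : IsVar p) : D0 fun c => (p c).IsTransitive :=
  .ball hp <| .subset .top hp.pop

theorem isOrdinal (hp : IsVar p) : D0 fun c => (p c).IsOrdinal := by
  have : D0 fun c => (p c).IsTransitive ∧ ∀ z ∈ p c, z.IsTransitive :=
    (isTransitive hp).and <| .ball hp <| isTransitive .top
  exact this.congr fun c => by rw [ZFSet.isOrdinal_iff_forall_mem_isTransitive]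

end D0

/-- `f` is a piece of the graph of the rank function whose domain is closed under elements. -/
def RankPiece (f : ZFSet.{u}) : Prop :=
  ∀ w a, ZFSet.pair w a ∈ f → a.IsOrdinal ∧ (∀ v ∈ w, ∃ b ∈ a, ZFSet.pair v b ∈ f) ∧
    ∀ b ∈ a, ∃ v ∈ w, ∃ b' ∈ a, ZFSet.pair v b' ∈ f ∧ b ⊆ b'

theorem D0.rankPiece {α : Type} {n : ℕ} {p : Ctx.{u} α n → ZFSet.{u}} (hp : IsVar p) :
    D0 fun c => RankPiece (p c) := by
  refine .forall_pair hp (.and (.isOrdinal .top) (.and ?_ ?_))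
  · exact .ball IsVar.top.pop <| .bex IsVar.top.pop <|
      .pair_mem IsVar.top.pop IsVar.top hp.pop.pop.pop.pop.pop.pop.pop
  · exact .ball IsVar.top <| .bex IsVar.top.pop.pop <| .bex IsVar.top.pop.pop <|
      .and (.pair_mem IsVar.top.pop IsVar.top hp.pop.pop.pop.pop.pop.pop.pop.pop)
        (.subset IsVar.top.pop.pop IsVar.top)

theorem toZFSet_subset_rank {a : ZFSet.{u}} (ha : a.IsOrdinal) {o : Ordinal.{u}} :
    a ⊆ o.toZFSet ↔ a.rank ≤ o := by
  conv_lhs => rw [← ha.toZFSet_rank_eq]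
  exact Ordinal.toZFSet_subset_toZFSet_iff

theorem mem_toZFSet_iff_rank {a : ZFSet.{u}} (ha : a.IsOrdinal) {o : Ordinal.{u}} :
    a ∈ o.toZFSet ↔ a.rank < o := by
  conv_lhs => rw [← ha.toZFSet_rank_eq]
  exact Ordinal.toZFSet_mem_toZFSet_iff

/-- By `∈`-induction on `w`: one clause puts the rank of every element of `w` into `a`, the other
bounds each element of `a` by such a rank. -/
theorem RankPiece.eq_rank {f : ZFSet.{u}} (hf : RankPiece f) (w : ZFSet.{u}) :
    ∀ a, ZFSet.pair w a ∈ f → a = w.rank.toZFSet := by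
  induction w using ZFSet.inductionOn with
  | _ w ih =>
    intro a ha
    obtain ⟨ho, h1, h2⟩ := hf w a ha
    ext b
    constructor
    · intro hb
      obtain ⟨v, hv, b', hb', hp, hs⟩ := h2 b hb
      obtain rfl := ih v hv _ hp
      rw [mem_toZFSet_iff_rank (ho.mem hb)]
      exact ((toZFSet_subset_rank (ho.mem hb)).1 hs).trans_lt (ZFSet.rank_lt_of_mem hv)
    · intro hb
      obtain ⟨β, hβ, rfl⟩ := Ordinal.mem_toZFSet_iff.1 hb
      obtain ⟨v, hv, hle⟩ := ZFSet.lt_rank_iff.1 hβ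
      obtain ⟨b, hb, hp⟩ := h1 v hv
      obtain rfl := ih v hv _ hp
      rcases hle.eq_or_lt with h | h
      · rwa [h]
      · exact ho.mem_trans (Ordinal.toZFSet_mem_toZFSet_iff.2 h) hb

namespace IsTransitiveModel

variable {W : Class.{u}}

theorem mem_trans (hW : IsTransitiveModel W) {x y : ZFSet.{u}} (h : x ∈ y) (hy : W y) : W x :=
  hW.transitive _ _ h hy

/-- The rank function is built inside `W` by `∈`-induction. The least piece defined at a given set
is unique, which is what replacement needs to collect the pieces for the elements of `y`; their
union, extended by `y` itself, is the least piece at `y`. -/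
theorem exists_rankPiece (hW : IsTransitiveModel W) (y : ZFSet.{u}) (hy : W y) :
    W y.rank.toZFSet ∧ ∃ f, W f ∧ RankPiece f ∧ (∃ a, ZFSet.pair y a ∈ f) ∧
      ∀ t, W t → RankPiece t → (∃ a, ZFSet.pair y a ∈ t) → f ⊆ t := by
  induction y using ZFSet.inductionOn with
  | _ y ih =>
    let R : Ctx.{u} (Fin 2) 1 → Prop := fun c => RankPiece (c.1 1) ∧
      (∃ a, ZFSet.pair (c.1 0) a ∈ c.1 1) ∧
        (RankPiece c.top → (∃ a, ZFSet.pair (c.1 0) a ∈ c.top) → c.1 1 ⊆ c.top)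
    have hR : D0 R := (D0.rankPiece (.fv _)).and <| .and (.mem_dom (.fv _) (.fv _)) <|
      (D0.rankPiece .top).imp <| (D0.mem_dom (.fv _) .top).imp <| .subset (.fv _) .top
    obtain ⟨Y, hWY, hY⟩ := hW.replacement hR hy (by
      intro z hz
      obtain ⟨f, hf, h1, h2, h3⟩ := (ih z hz (hW.mem_trans hz hy)).2
      refine ⟨f, ⟨hf, fun t ht => ⟨h1, h2, h3 t ht⟩⟩, ?_⟩
      rintro f' ⟨hf', h'⟩
      refine le_antisymm ((h' f hf).2.2 h1 h2) (h3 f' hf' (h' f hf).1 (h' f hf).2.1))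
    let u := ZFSet.sUnion Y
    have hWu : W u := hW.sUnion hWY
    have hu : RankPiece u := by
      intro w a h
      obtain ⟨f, hf, hp⟩ := ZFSet.mem_sUnion.1 h
      obtain ⟨hWf, z, hz, hr⟩ := (hY f).1 hf
      have hsub : f ⊆ u := fun x hx => ZFSet.mem_sUnion.2 ⟨f, hf, hx⟩
      obtain ⟨h1, h2, h3⟩ := (hr f hWf).1 w a hp
      refine ⟨h1, fun v hv => ?_, fun b hb => ?_⟩
      · obtain ⟨b, hb, h⟩ := h2 v hv
        exact ⟨b, hb, hsub h⟩
      · obtain ⟨v, hv, b', hb', h, h'⟩ := h3 b hb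
        exact ⟨v, hv, b', hb', hsub h, h'⟩
    have hdom : ∀ z ∈ y, ZFSet.pair z z.rank.toZFSet ∈ u := by
      intro z hz
      obtain ⟨f, hf, h1, ⟨a, ha⟩, h3⟩ := (ih z hz (hW.mem_trans hz hy)).2
      have hfY : f ∈ Y := (hY f).2 ⟨hf, z, hz, fun t ht => ⟨h1, ⟨a, ha⟩, h3 t ht⟩⟩
      rw [← h1.eq_rank z a ha]
      exact ZFSet.mem_sUnion.2 ⟨f, hfY, ha⟩
    have hrank : W y.rank.toZFSet := by
      let A := ZFSet.sep (fun a => ∃ z ∈ y, ZFSet.pair z a ∈ u) (ZFSet.sUnion (ZFSet.sUnion u))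
      have hA : W A := hW.sep ![⟨y, hy⟩, ⟨u, hWu⟩]
        (R := fun c => ∃ z ∈ c.1 0, ZFSet.pair z c.top ∈ c.1 1)
        (.bex (.fv _) (.pair_mem .top IsVar.top.pop (.fv _))) (hW.sUnion (hW.sUnion hWu))
      have hmA : ∀ a, a ∈ A ↔ ∃ z ∈ y, a = z.rank.toZFSet := by
        intro a
        rw [ZFSet.mem_sep]
        constructor
        · rintro ⟨_, z, hz, h⟩
          exact ⟨z, hz, hu.eq_rank _ _ h⟩
        · rintro ⟨z, hz, rfl⟩
          refine ⟨?_, z, hz, hdom z hz⟩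
          refine ZFSet.mem_sUnion.2 ⟨{z, z.rank.toZFSet}, ZFSet.mem_sUnion.2 ⟨_, hdom z hz, ?_⟩, ?_⟩
          · simp [ZFSet.pair]
          · simp
      -- `A` is the set of ranks of elements of `y`, and the rank of `y` is the supremum of their
      -- successors.
      have : y.rank.toZFSet = ZFSet.sUnion A ∪ A := by
        ext b
        rw [Ordinal.mem_toZFSet_iff, ZFSet.mem_union, ZFSet.mem_sUnion]
        constructor
        · rintro ⟨β, hβ, rfl⟩
          obtain ⟨v, hv, hle⟩ := ZFSet.lt_rank_iff.1 hβ
          rcases hle.eq_or_lt with h | h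
          · exact Or.inr ((hmA _).2 ⟨v, hv, by rw [h]⟩)
          · exact Or.inl ⟨_, (hmA _).2 ⟨v, hv, rfl⟩, Ordinal.toZFSet_mem_toZFSet_iff.2 h⟩
        · rintro (⟨a, ha, hb⟩ | ha)
          · obtain ⟨z, hz, rfl⟩ := (hmA _).1 ha
            obtain ⟨β, hβ, rfl⟩ := Ordinal.mem_toZFSet_iff.1 hb
            exact ⟨β, hβ.trans (ZFSet.rank_lt_of_mem hz), rfl⟩
          · obtain ⟨z, hz, rfl⟩ := (hmA _).1 ha
            exact ⟨_, ZFSet.rank_lt_of_mem hz, rfl⟩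
      rw [this]
      exact hW.union (hW.sUnion hA) hA
    refine ⟨hrank, insert (ZFSet.pair y y.rank.toZFSet) u, hW.insert_set (hW.pair hy hrank) hWu, ?_,
      ⟨_, ZFSet.mem_insert _ _⟩, ?_⟩
    · intro w a h
      rcases ZFSet.mem_insert_iff.1 h with h | h
      · obtain ⟨rfl, rfl⟩ := ZFSet.pair_inj.1 h
        refine ⟨ZFSet.isOrdinal_toZFSet _, fun v hv => ⟨_, Ordinal.toZFSet_mem_toZFSet_iff.2
          (ZFSet.rank_lt_of_mem hv), ZFSet.mem_insert_of_mem _ (hdom v hv)⟩, fun b hb => ?_⟩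
        obtain ⟨β, hβ, rfl⟩ := Ordinal.mem_toZFSet_iff.1 hb
        obtain ⟨v, hv, hle⟩ := ZFSet.lt_rank_iff.1 hβ
        exact ⟨v, hv, _, Ordinal.toZFSet_mem_toZFSet_iff.2
          (ZFSet.rank_lt_of_mem hv), ZFSet.mem_insert_of_mem _ (hdom v hv),
          Ordinal.toZFSet_subset_toZFSet_iff.2 hle⟩
      · obtain ⟨h1, h2, h3⟩ := hu w a h
        refine ⟨h1, fun v hv => ?_, fun b hb => ?_⟩
        · obtain ⟨b, hb, h⟩ := h2 v hv
          exact ⟨b, hb, ZFSet.mem_insert_of_mem _ h⟩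
        · obtain ⟨v, hv, b', hb', h, h'⟩ := h3 b hb
          exact ⟨v, hv, b', hb', ZFSet.mem_insert_of_mem _ h, h'⟩
    · rintro t ht hr ⟨a, ha⟩ x hx
      rcases ZFSet.mem_insert_iff.1 hx with rfl | h
      · rwa [← hr.eq_rank _ _ ha]
      · obtain ⟨f, hf, hxf⟩ := ZFSet.mem_sUnion.1 h
        obtain ⟨hWf, z, hz, hr'⟩ := (hY f).1 hf
        obtain ⟨_, h2, _⟩ := hr y a ha
        obtain ⟨b, _, hb⟩ := h2 z hz
        exact (hr' t ht).2.2 hr ⟨b, hb⟩ hxf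

/-- If an ordinal were missing, the ranks of all elements of `W` would lie below it, and `W` would
be a set. -/
theorem toZFSet (hW : IsTransitiveModel W) (o : Ordinal.{u}) : W o.toZFSet := by
  by_contra ho
  apply hW.proper
  rw [Class.mem_univ]
  have hr : ∀ x, W x → x.rank < o := by
    intro x hx
    by_contra hlt
    rcases (not_lt.1 hlt).eq_or_lt with h | h
    · exact ho (h ▸ (hW.exists_rankPiece x hx).1)
    · exact ho (hW.mem_trans (Ordinal.toZFSet_mem_toZFSet_iff.2 h) (hW.exists_rankPiece x hx).1)
  refine ⟨ZFSet.sep (fun x => W x) (ZFSet.vonNeumann o), ?_⟩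
  apply Class.ext
  intro x
  change x ∈ ZFSet.sep _ _ ↔ W x
  rw [ZFSet.mem_sep, ZFSet.mem_vonNeumann]
  exact ⟨fun h => h.2, fun h => ⟨hr x h, h⟩⟩

end IsTransitiveModel

/-! ### Graphs of functions on ordinals -/

/-- The graph of the restriction of `g` to the ordinal `τ`. -/
noncomputable def graph (τ : Ordinal.{u}) (g : Ordinal.{u} → ZFSet.{u}) : ZFSet.{u} :=
  ZFSet.range fun i : Set.Iio τ => ZFSet.pair i.1.toZFSet (g i)

theorem mem_graph {τ : Ordinal.{u}} {g : Ordinal.{u} → ZFSet.{u}} {e : ZFSet.{u}} :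
    e ∈ graph τ g ↔ ∃ i < τ, e = ZFSet.pair i.toZFSet (g i) := by
  simp [graph, eq_comm]

theorem pair_mem_graph {τ : Ordinal.{u}} {g : Ordinal.{u} → ZFSet.{u}} {x y : ZFSet.{u}} :
    ZFSet.pair x y ∈ graph τ g ↔ ∃ i < τ, x = i.toZFSet ∧ y = g i := by
  simp [mem_graph, ZFSet.pair_inj]

theorem toZFSet_pair_mem_graph {τ i : Ordinal.{u}} {g : Ordinal.{u} → ZFSet.{u}} {y : ZFSet.{u}} :
    ZFSet.pair i.toZFSet y ∈ graph τ g ↔ i < τ ∧ y = g i := by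
  rw [pair_mem_graph]
  constructor
  · rintro ⟨k, hk, h1, h2⟩
    obtain rfl := Ordinal.toZFSet_injective h1
    exact ⟨hk, h2⟩
  · rintro ⟨h1, h2⟩
    exact ⟨i, h1, rfl, h2⟩

namespace IsTransitiveModel

variable {W : Class.{u}}

theorem pair_mem_pw (hW : IsTransitiveModel W) {x a b : ZFSet.{u}} (hx : W x) (ha : a ∈ x)
    (hb : b ∈ x) : ZFSet.pair a b ∈ InnerModel.pw W (InnerModel.pw W x) := by
  have hWa := hW.mem_trans ha hx
  have hWb := hW.mem_trans hb hx
  refine mem_pw.2 ⟨hW.pair hWa hWb, fun s hs => mem_pw.2 ⟨?_, fun z hz => ?_⟩⟩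
  · exact hW.mem_trans hs (hW.pair hWa hWb)
  · simp only [ZFSet.pair, ZFSet.mem_pair] at hs
    rcases hs with rfl | rfl
    · simp only [ZFSet.mem_singleton] at hz
      rwa [hz]
    · simp only [ZFSet.mem_pair] at hz
      rcases hz with rfl | rfl <;> assumption

/-- Supplies the bound for quantifiers over functions, which keeps the relations about ladders and
listings `Δ₀`. -/
theorem graph_mem_pw (hW : IsTransitiveModel W) {x : ZFSet.{u}} (hx : W x) {τ : Ordinal.{u}}
    {g : Ordinal.{u} → ZFSet.{u}} (hτ : τ.toZFSet ⊆ x) (hg : ∀ i < τ, g i ∈ x)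
    (h : W (graph τ g)) :
    graph τ g ∈ InnerModel.pw W (InnerModel.pw W (InnerModel.pw W x)) := by
  refine mem_pw.2 ⟨h, fun e he => ?_⟩
  obtain ⟨i, hi, rfl⟩ := mem_graph.1 he
  exact hW.pair_mem_pw hx (hτ (Ordinal.toZFSet_mem_toZFSet_iff.2 hi)) (hg i hi)

/-- A function on an ordinal with a `Δ₀` definition belongs to the model. -/
theorem graph_mem (hW : IsTransitiveModel W) {k : ℕ} (v : Fin k → Elem W) (a b : Fin k)
    {Q : (Fin k → ZFSet.{u}) → ZFSet.{u} → ZFSet.{u} → Prop}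
    (hQ : D0 fun c : Ctx.{u} (Fin k) 3 => Q c.1 c.pop.top c.top) {τ : Ordinal.{u}}
    {g : Ordinal.{u} → ZFSet.{u}} (ha : (v a).val = τ.toZFSet)
    (hg : ∀ i < τ, ∀ y, y ∈ (v b).val ∧ Q (fun i => (v i).val) i.toZFSet y ↔ y = g i) :
    W (graph τ g) := by
  have hx : W (τ.toZFSet ∪ (v b).val) := hW.union (hW.toZFSet τ) (v b).2
  have := hW.sep v (R := fun c => ∃ i ∈ c.1 a, ∃ y ∈ c.1 b, c.top = ZFSet.pair i y ∧ Q c.1 i y)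
    (.bex (.fv _) <| .bex (.fv _) <| .and (.eq_pair IsVar.top.pop.pop IsVar.top.pop .top) hQ)
    (hW.pw (hW.pw hx))
  convert this
  ext e
  rw [ZFSet.mem_sep, mem_graph]
  constructor
  · rintro ⟨i, hi, rfl⟩
    have hy := (hg i hi (g i)).2 rfl
    have hiτ : i.toZFSet ∈ τ.toZFSet := Ordinal.toZFSet_mem_toZFSet_iff.2 hi
    refine ⟨hW.pair_mem_pw hx (ZFSet.mem_union.2 (Or.inl hiτ)) (ZFSet.mem_union.2 (Or.inr hy.1)),
      i.toZFSet, ?_, g i, hy.1, rfl, hy.2⟩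
    change _ ∈ (v a).val
    rwa [ha]
  · rintro ⟨_, i, hi, y, hy, rfl, hq⟩
    change _ ∈ (v a).val at hi
    rw [ha] at hi
    obtain ⟨i, hi', rfl⟩ := Ordinal.mem_toZFSet_iff.1 hi
    exact ⟨i, hi', by rw [(hg i hi' y).1 ⟨hy, hq⟩]⟩

end IsTransitiveModel

/-! ### Enumerations by recursion -/

/-- The function which lists the elements of `X` in the order dictated by the choice set `c`. -/
noncomputable def listing (X c : ZFSet.{u}) (i : Ordinal.{u}) : ZFSet.{u} :=
  Classical.epsilon fun z =>
    z ∈ ZFSet.sep (fun z => ∀ k (_ : k < i), listing X c k ≠ z) X ∧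
      ZFSet.pair (ZFSet.sep (fun z => ∀ k (_ : k < i), listing X c k ≠ z) X) z ∈ c
termination_by i

/-- The elements of `X` which `g` does not list before stage `i`. -/
noncomputable def remaining (X : ZFSet.{u}) (g : Ordinal.{u} → ZFSet.{u}) (i : Ordinal.{u}) :
    ZFSet.{u} :=
  ZFSet.sep (fun z => ∀ k < i, g k ≠ z) X

theorem listing_eq (X c : ZFSet.{u}) (i : Ordinal.{u}) :
    listing X c i = Classical.epsilon fun z => z ∈ remaining X (listing X c) i ∧
      ZFSet.pair (remaining X (listing X c) i) z ∈ c := by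
  rw [listing]
  rfl

/-- `y` is the element of `X` which the choice set `c` dictates after `f` restricted to `i`. -/
def ListingStep (X c P f i y : ZFSet.{u}) : Prop :=
  ∃ s ∈ P, (∀ z ∈ X, z ∈ s ↔ ¬ ∃ k ∈ i, ZFSet.pair k z ∈ f) ∧ y ∈ s ∧ ZFSet.pair s y ∈ c

/-- `f` is the listing of `X` up to `i`. -/
def IsListing (X c P f i : ZFSet.{u}) : Prop :=
  (∀ e ∈ f, ∃ k ∈ i, ∃ y ∈ X, e = ZFSet.pair k y ∧ ListingStep X c P f k y) ∧
    ∀ k ∈ i, ∃ y ∈ X, ZFSet.pair k y ∈ f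

section

variable {α : Type} {n : ℕ} {p q r s t w : Ctx.{u} α n → ZFSet.{u}}

theorem D0.listingStep (hp : IsVar p) (hq : IsVar q) (hr : IsVar r) (hs : IsVar s) (ht : IsVar t)
    (hw : IsVar w) : D0 fun c => ListingStep (p c) (q c) (r c) (s c) (t c) (w c) :=
  .bex hr <| .and
    (.ball hp.pop <| .iff (.mem .top IsVar.top.pop) <| .not <| .bex ht.pop.pop <|
      .pair_mem .top IsVar.top.pop hs.pop.pop.pop)
    (.and (.mem hw.pop .top) (.pair_mem .top hw.pop hq.pop))

theorem D0.isListing (hp : IsVar p) (hq : IsVar q) (hr : IsVar r) (hs : IsVar s) (ht : IsVar t) :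
    D0 fun c => IsListing (p c) (q c) (r c) (s c) (t c) :=
  .and
    (.ball hs <| .bex ht.pop <| .bex hp.pop.pop <| .and
      (.eq_pair IsVar.top.pop.pop IsVar.top.pop .top)
      (.listingStep hp.pop.pop.pop hq.pop.pop.pop hr.pop.pop.pop hs.pop.pop.pop IsVar.top.pop .top))
    (.ball ht <| .bex hp.pop <| .pair_mem IsVar.top.pop .top hs.pop.pop)

end

namespace IsTransitiveModel

variable {W : Class.{u}}

section

variable {X c : ZFSet.{u}}

theorem remaining_mem (hW : IsTransitiveModel W) (hX : W X) {g : Ordinal.{u} → ZFSet.{u}}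
    {i : Ordinal.{u}} (h : W (graph i g)) : W (remaining X g i) := by
  have := hW.sep ![⟨i.toZFSet, hW.toZFSet i⟩, ⟨_, h⟩]
    (R := fun c => ¬ ∃ k ∈ c.1 0, ZFSet.pair k c.top ∈ c.1 1)
    (.not <| .bex (.fv _) <| .pair_mem .top IsVar.top.pop (.fv _)) hX
  convert this using 1
  unfold remaining
  congr 1
  funext z
  refine propext ⟨?_, ?_⟩
  · rintro h ⟨k, hk, hp⟩
    obtain ⟨k, hk', rfl, rfl⟩ := pair_mem_graph.1 hp
    exact h k hk' rfl
  · rintro h k hk rfl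
    exact h ⟨k.toZFSet, Ordinal.toZFSet_mem_toZFSet_iff.2 hk, toZFSet_pair_mem_graph.2 ⟨hk, rfl⟩⟩

theorem listing_spec (hW : IsTransitiveModel W) (hX : W X)
    (hch : ∀ s, W s → s ⊆ X → s.Nonempty → ∃! z, z ∈ s ∧ ZFSet.pair s z ∈ c) {i : Ordinal.{u}}
    (h : W (graph i (listing X c))) (hne : (remaining X (listing X c) i).Nonempty) (y : ZFSet.{u}) :
    (y ∈ remaining X (listing X c) i ∧ ZFSet.pair (remaining X (listing X c) i) y ∈ c) ↔
      y = listing X c i := by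
  obtain ⟨z, hz, hu⟩ := hch _ (hW.remaining_mem hX h) ZFSet.sep_subset hne
  have := Classical.epsilon_spec (p := fun z => z ∈ remaining X (listing X c) i ∧
      ZFSet.pair (remaining X (listing X c) i) z ∈ c) ⟨z, hz⟩
  rw [← listing_eq] at this
  constructor
  · intro h
    exact (hu y h).trans (hu _ this).symm
  · rintro rfl
    exact this

/-- Transfinite recursion inside `W`. All values lie in `X`, so separation suffices: the value at
`k` is computed from the unique partial listing of length `k`, which is found in the triple power
set of `i ∪ X`. -/
theorem graph_listing_mem (hW : IsTransitiveModel W) (hX : W X) (hc : W c)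
    (hch : ∀ s, W s → s ⊆ X → s.Nonempty → ∃! z, z ∈ s ∧ ZFSet.pair s z ∈ c) (i : Ordinal.{u})
    (hne : ∀ k < i, (remaining X (listing X c) k).Nonempty) :
    W (graph i (listing X c)) := by
  induction i using WellFoundedLT.induction with
  | _ i ih =>
    have hg : ∀ k < i, W (graph k (listing X c)) := fun k hk =>
      ih k hk fun l hl => hne l (hl.trans hk)
    have hspec := fun k hk y => hW.listing_spec hX hch (hg k hk) (hne k hk) y
    have hXg : ∀ k < i, listing X c k ∈ X := fun k hk =>
      (ZFSet.mem_sep.1 ((hspec k hk _).2 rfl).1).1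
    have hP := hW.pw hX
    have hx : W (i.toZFSet ∪ X) := hW.union (hW.toZFSet i) hX
    have hB := hW.pw (hW.pw (hW.pw hx))
    have hrem : ∀ k < i, remaining X (listing X c) k ∈ InnerModel.pw W X := fun k hk =>
      mem_pw.2 ⟨hW.remaining_mem hX (hg k hk), ZFSet.sep_subset⟩
    -- the step relation picks the next value, as soon as `f` agrees with the listing below `k`
    have hstep : ∀ f, ∀ k < i, (∀ l < k, ∀ z ∈ X, ZFSet.pair l.toZFSet z ∈ f ↔ z = listing X c l) →
        ∀ y, ListingStep X c (InnerModel.pw W X) f k.toZFSet y ↔ y = listing X c k := by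
      intro f k hk hf y
      have hs : ∀ s ∈ InnerModel.pw W X, (∀ z ∈ X, z ∈ s ↔ ¬ ∃ l ∈ k.toZFSet, ZFSet.pair l z ∈ f) ↔
          s = remaining X (listing X c) k := by
        intro s hs
        have hz : ∀ z ∈ X, (¬ ∃ l ∈ k.toZFSet, ZFSet.pair l z ∈ f) ↔
            z ∈ remaining X (listing X c) k := by
          intro z hz
          rw [remaining, ZFSet.mem_sep]
          constructor
          · rintro h
            refine ⟨hz, ?_⟩
            rintro l hl rfl
            exact h ⟨_, Ordinal.toZFSet_mem_toZFSet_iff.2 hl, (hf l hl _ hz).2 rfl⟩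
          · rintro ⟨_, h⟩ ⟨l, hl, hp⟩
            obtain ⟨l, hl', rfl⟩ := Ordinal.mem_toZFSet_iff.1 hl
            exact h l hl' ((hf l hl' z hz).1 hp).symm
        constructor
        · intro h
          ext z
          constructor
          · intro hzs
            have := (mem_pw.1 hs).2 hzs
            exact (hz z this).1 ((h z this).1 hzs)
          · intro hzs
            have := (ZFSet.mem_sep.1 hzs).1
            exact (h z this).2 ((hz z this).2 hzs)
        · rintro rfl z hz'
          exact (hz z hz').symm
      rw [← hspec k hk y]
      constructor
      · rintro ⟨s, hsP, h1, h2⟩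
        rw [(hs s hsP).1 h1] at h2
        exact h2
      · rintro h
        exact ⟨_, hrem k hk, (hs _ (hrem k hk)).2 rfl, h⟩
    have hlist : ∀ k < i, ∀ f, IsListing X c (InnerModel.pw W X) f k.toZFSet ↔
        f = graph k (listing X c) := by
      intro k hk f
      constructor
      · intro ⟨h1, h2⟩
        have hval : ∀ l < k, ∀ z ∈ X, ZFSet.pair l.toZFSet z ∈ f ↔ z = listing X c l := by
          intro l
          induction l using WellFoundedLT.induction with
          | _ l ihl =>
            intro hl
            have key : ∀ z, ZFSet.pair l.toZFSet z ∈ f → z = listing X c l := by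
              intro z hz
              obtain ⟨l', _, y, _, he, hs⟩ := h1 _ hz
              obtain ⟨rfl, rfl⟩ := ZFSet.pair_inj.1 he
              exact (hstep f l (hl.trans hk) (fun m hm => ihl m hm (hm.trans hl)) _).1 hs
            intro z _
            refine ⟨key z, ?_⟩
            rintro rfl
            obtain ⟨y, _, hy⟩ := h2 _ (Ordinal.toZFSet_mem_toZFSet_iff.2 hl)
            rwa [← key y hy]
        ext e
        rw [mem_graph]
        constructor
        · intro he
          obtain ⟨l, hl, y, hy, rfl, _⟩ := h1 e he
          obtain ⟨l, hl', rfl⟩ := Ordinal.mem_toZFSet_iff.1 hl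
          exact ⟨l, hl', by rw [(hval l hl' y hy).1 he]⟩
        · rintro ⟨l, hl, rfl⟩
          exact (hval l hl _ (hXg l (hl.trans hk))).2 rfl
      · rintro rfl
        refine ⟨fun e he => ?_, fun l hl => ?_⟩
        · obtain ⟨l, hl, rfl⟩ := mem_graph.1 he
          refine ⟨_, Ordinal.toZFSet_mem_toZFSet_iff.2 hl, _, hXg l (hl.trans hk), rfl, ?_⟩
          refine (hstep _ l (hl.trans hk) (fun m hm z _ => ?_) _).2 rfl
          rw [toZFSet_pair_mem_graph, and_iff_right (hm.trans hl)]
        · obtain ⟨l, hl', rfl⟩ := Ordinal.mem_toZFSet_iff.1 hl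
          exact ⟨_, hXg l (hl'.trans hk), toZFSet_pair_mem_graph.2 ⟨hl', rfl⟩⟩
    refine hW.graph_mem ![⟨_, hW.toZFSet i⟩, ⟨X, hX⟩, ⟨c, hc⟩, ⟨_, hP⟩, ⟨_, hB⟩] 0 1
      (Q := fun v k y => ∃ f ∈ v 4, IsListing (v 1) (v 2) (v 3) f k ∧
        ListingStep (v 1) (v 2) (v 3) f k y)
      (.bex (.fv _) <| .and (.isListing (.fv _) (.fv _) (.fv _) .top IsVar.top.pop.pop)
        (.listingStep (.fv _) (.fv _) (.fv _) .top IsVar.top.pop.pop IsVar.top.pop)) rfl ?_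
    intro k hk y
    change (y ∈ X ∧ ∃ f ∈ InnerModel.pw W _, IsListing X c (InnerModel.pw W X) f _ ∧
      ListingStep X c (InnerModel.pw W X) f _ y) ↔ _
    have hfk : ∀ l < k, ∀ z ∈ X, ZFSet.pair l.toZFSet z ∈ graph k (listing X c) ↔
        z = listing X c l := fun m hm z _ => by
      rw [toZFSet_pair_mem_graph, and_iff_right hm]
    constructor
    · rintro ⟨_, f, _, h1, h2⟩
      obtain rfl := (hlist k hk f).1 h1
      exact (hstep _ k hk hfk y).1 h2
    · rintro rfl
      refine ⟨hXg k hk, _, ?_, (hlist k hk _).2 rfl, (hstep _ k hk hfk _).2 rfl⟩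
      refine hW.graph_mem_pw hx (fun z hz => ?_) (fun l hl => ?_) (hg k hk)
      · obtain ⟨l, hl, rfl⟩ := Ordinal.mem_toZFSet_iff.1 hz
        exact ZFSet.mem_union.2 (Or.inl (Ordinal.toZFSet_mem_toZFSet_iff.2 (hl.trans hk)))
      · exact ZFSet.mem_union.2 (Or.inr (hXg l (hl.trans hk)))

/-- A set with a choice set for its nonempty subsets is enumerated by an ordinal. -/
theorem exists_listing (hW : IsTransitiveModel W) (hX : W X) (hc : W c)
    (hch : ∀ s, W s → s ⊆ X → s.Nonempty → ∃! z, z ∈ s ∧ ZFSet.pair s z ∈ c) :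
    ∃ (τ : Ordinal.{u}) (g : Ordinal.{u} → ZFSet.{u}), W (graph τ g) ∧
      (∀ i < τ, g i ∈ remaining X g i ∧ ZFSet.pair (remaining X g i) (g i) ∈ c) ∧
      ∀ z ∈ X, ∃ i < τ, g i = z := by
  have hex : ∃ τ, ¬ (remaining X (listing X c) τ).Nonempty := by
    by_contra! hne
    have hg : ∀ i, W (graph i (listing X c)) := fun i =>
      hW.graph_listing_mem hX hc hch i fun k _ => hne k
    have hm : ∀ i, listing X c i ∈ remaining X (listing X c) i := fun i =>
      ((hW.listing_spec hX hch (hg i) (hne i) _).2 rfl).1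
    -- A listing that never stops would inject all ordinals into the set `X`.
    let F : Ordinal.{u} → Shrink.{u} X := fun i =>
      equivShrink X ⟨listing X c i, (ZFSet.mem_sep.1 (hm i)).1⟩
    refine not_injective_of_ordinal F fun i k h => ?_
    have h' : listing X c i = listing X c k := by
      simpa [F] using h
    by_contra hik
    rcases lt_or_gt_of_ne hik with hlt | hlt
    · exact (ZFSet.mem_sep.1 (hm k)).2 i hlt h'
    · exact (ZFSet.mem_sep.1 (hm i)).2 k hlt h'.symm
  obtain ⟨τ, hτ, hmin⟩ := WellFounded.has_min (wellFounded_lt (α := Ordinal.{u}))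
    {τ | ¬ (remaining X (listing X c) τ).Nonempty} hex
  have hne : ∀ k < τ, (remaining X (listing X c) k).Nonempty := fun k hk => by
    by_contra h
    exact hmin k h hk
  have hg : ∀ i ≤ τ, W (graph i (listing X c)) := fun i hi =>
    hW.graph_listing_mem hX hc hch i fun k hk => hne k (hk.trans_le hi)
  refine ⟨τ, listing X c, hg τ le_rfl, fun i hi =>
    (hW.listing_spec hX hch (hg i hi.le) (hne i hi) _).2 rfl, fun z hz => ?_⟩
  by_contra! h
  exact hτ ⟨z, ZFSet.mem_sep.2 ⟨hz, h⟩⟩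

end

end IsTransitiveModel

/-- The graph of the restriction of an ordinal valued function to the ordinal `τ`. -/
noncomputable abbrev ograph (τ : Ordinal.{u}) (h : Ordinal.{u} → Ordinal.{u}) : ZFSet.{u} :=
  graph τ fun i => (h i).toZFSet

theorem pair_mem_ograph {τ i a : Ordinal.{u}} {h : Ordinal.{u} → Ordinal.{u}} :
    ZFSet.pair i.toZFSet a.toZFSet ∈ ograph τ h ↔ i < τ ∧ a = h i := by
  rw [toZFSet_pair_mem_graph, Ordinal.toZFSet_injective.eq_iff]

namespace IsTransitiveModel

variable {W : Class.{u}}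

/-- Every set of ordinals in the model is enumerated increasingly in the model. -/
theorem exists_strictMono_enum (hW : IsTransitiveModel W) {X : ZFSet.{u}} (hX : W X)
    (ho : ∀ z ∈ X, z.IsOrdinal) :
    ∃ (τ : Ordinal.{u}) (h : Ordinal.{u} → Ordinal.{u}), W (ograph τ h) ∧
      StrictMonoOn h (Set.Iio τ) ∧ ∀ β : Ordinal.{u}, β.toZFSet ∈ X ↔ ∃ i < τ, h i = β := by
  have hP := hW.pw hX
  have hU := hW.union hX hP
  -- `c` pairs each subset of `X` in `W` with its least element (inclusion is the order of
  -- ordinals), so the listing it dictates is increasing.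
  have hc := hW.sep ![⟨_, hX⟩, ⟨_, hP⟩]
    (R := fun c => ∃ s ∈ c.1 1, ∃ z ∈ s, c.top = ZFSet.pair s z ∧ ∀ w ∈ s, z ⊆ w)
    (.bex (.fv _) <| .bex .top <| .and (.eq_pair IsVar.top.pop.pop IsVar.top.pop .top) <|
      .ball IsVar.top.pop <| .subset IsVar.top.pop .top) (hW.pw (hW.pw hU))
  set c := ZFSet.sep _ _ with hcdef
  have hmc : ∀ s z, ZFSet.pair s z ∈ c ↔ (W s ∧ s ⊆ X) ∧ z ∈ s ∧ ∀ w ∈ s, z ⊆ w := by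
    intro s z
    rw [hcdef, ZFSet.mem_sep]
    constructor
    · rintro ⟨_, s', hs', z', hz', he, h⟩
      obtain ⟨rfl, rfl⟩ := ZFSet.pair_inj.1 he
      exact ⟨mem_pw.1 hs', hz', h⟩
    · rintro ⟨hs, hz, h⟩
      refine ⟨hW.pair_mem_pw hU (ZFSet.mem_union.2 (Or.inr (mem_pw.2 hs)))
        (ZFSet.mem_union.2 (Or.inl (hs.2 hz))), s, mem_pw.2 hs, z, hz, rfl, h⟩
  obtain ⟨τ, g, hg, h1, h2⟩ := hW.exists_listing hX hc (by
    intro s hs hsX hne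
    obtain ⟨z, hz, hmin⟩ := ZFSet.mem_wf.has_min {z | z ∈ s} hne
    have hle : ∀ w ∈ s, z ⊆ w := fun w hw =>
      ((ho w (hsX hw)).notMem_iff_subset (ho z (hsX hz))).1 (hmin w hw)
    refine ⟨z, ⟨hz, (hmc s z).2 ⟨⟨hs, hsX⟩, hz, hle⟩⟩, ?_⟩
    rintro w ⟨hw, hwc⟩
    exact le_antisymm (((hmc s w).1 hwc).2.2 z hz) (hle w hw))
  have hgX : ∀ i < τ, g i ∈ X := fun i hi => (ZFSet.mem_sep.1 (h1 i hi).1).1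
  have hgo : ∀ i < τ, (g i).rank.toZFSet = g i := fun i hi =>
    (ho _ (hgX i hi)).toZFSet_rank_eq
  refine ⟨τ, fun i => (g i).rank, ?_, ?_, ?_⟩
  · convert hg using 1
    ext e
    simp only [mem_graph]
    exact exists_congr fun i => and_congr_right fun hi => by rw [hgo i hi]
  · intro i hi k hk hik
    have hsub : g i ⊆ g k := by
      refine ((hmc _ _).1 (h1 i hi).2).2.2 _ (ZFSet.mem_sep.2 ⟨hgX k hk, fun l hl => ?_⟩)
      exact (ZFSet.mem_sep.1 (h1 k hk).1).2 l (hl.trans hik)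
    refine lt_of_le_of_ne (ZFSet.rank_mono hsub) fun h => ?_
    refine (ZFSet.mem_sep.1 (h1 k hk).1).2 i hik ?_
    rw [← hgo i hi, ← hgo k hk]
    exact congrArg _ h
  · intro β
    constructor
    · intro hβ
      obtain ⟨i, hi, h⟩ := h2 _ hβ
      exact ⟨i, hi, (congrArg ZFSet.rank h).trans (Ordinal.rank_toZFSet β)⟩
    · rintro ⟨i, hi, rfl⟩
      rw [hgo i hi]
      exact hgX i hi

/-- Every set in the model is the image of an ordinal under a function in the model. -/
theorem exists_surjection (hW : IsTransitiveModel W) {X : ZFSet.{u}} (hX : W X) :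
    ∃ (τ : Ordinal.{u}) (g : Ordinal.{u} → ZFSet.{u}), W (graph τ g) ∧ (∀ i < τ, g i ∈ X) ∧
      ∀ z ∈ X, ∃ i < τ, g i = z := by
  have hP := hW.pw hX
  have hU := hW.union hX hP
  have hB := hW.pw (hW.pw hU)
  -- the family of the sets `{s} × s`
  have hF := hW.sep ![⟨_, hP⟩]
    (R := fun c => ∃ s ∈ c.1 0, s.Nonempty ∧ (∀ e ∈ c.top, ∃ z ∈ s, e = ZFSet.pair s z) ∧
      ∀ z ∈ s, ZFSet.pair s z ∈ c.top)
    (.bex (.fv _) <| .and (.nonempty .top) <| .and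
      (.ball IsVar.top.pop <| .bex IsVar.top.pop <| .eq_pair IsVar.top.pop IsVar.top.pop.pop .top)
      (.ball .top <| .pair_mem IsVar.top.pop .top IsVar.top.pop.pop)) (hW.pw hB)
  set F := ZFSet.sep _ _ with hFdef
  have hmF : ∀ y, y ∈ F ↔ (W y ∧ y ⊆ InnerModel.pw W (InnerModel.pw W (X ∪ InnerModel.pw W X))) ∧
      ∃ s, (W s ∧ s ⊆ X) ∧ s.Nonempty ∧ (∀ e ∈ y, ∃ z ∈ s, e = ZFSet.pair s z) ∧
        ∀ z ∈ s, ZFSet.pair s z ∈ y := by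
    intro y
    rw [hFdef, ZFSet.mem_sep, mem_pw]
    refine and_congr_right fun _ => exists_congr fun s => and_congr_left fun _ => ?_
    exact mem_pw
  -- The first coordinate makes the sets disjoint, so a transversal contains the graph of a choice
  -- function on the nonempty subsets of `X` in `W`.
  obtain ⟨c, hc, hc1⟩ := hW.choice hF
    (by
      intro y hy
      obtain ⟨_, s, _, ⟨z, hz⟩, _, h⟩ := (hmF y).1 hy
      exact ⟨_, h z hz⟩)
    (by
      intro y hy y' hy' e he he'
      obtain ⟨_, s, _, _, h1, h2⟩ := (hmF y).1 hy
      obtain ⟨_, s', _, _, h1', h2'⟩ := (hmF y').1 hy'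
      obtain ⟨z, hz, rfl⟩ := h1 e he
      obtain ⟨z', hz', he⟩ := h1' _ he'
      obtain ⟨rfl, rfl⟩ := ZFSet.pair_inj.1 he
      ext e
      constructor
      · intro h
        obtain ⟨w, hw, rfl⟩ := h1 e h
        exact h2' w hw
      · intro h
        obtain ⟨w, hw, rfl⟩ := h1' e h
        exact h2 w hw)
  obtain ⟨τ, g, hg, h1, h2⟩ := hW.exists_listing hX hc (by
    intro s hs hsX hne
    have hy := hW.sep ![⟨s, hs⟩] (R := fun c => ∃ z ∈ c.1 0, c.top = ZFSet.pair (c.1 0) z)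
      (.bex (.fv _) <| .eq_pair IsVar.top.pop (.fv _) .top) hB
    set y := ZFSet.sep _ _ with hydef
    have hmy : ∀ e, e ∈ y ↔ ∃ z ∈ s, e = ZFSet.pair s z := by
      intro e
      rw [hydef, ZFSet.mem_sep]
      refine ⟨fun h => h.2, fun h => ⟨?_, h⟩⟩
      obtain ⟨z, hz, rfl⟩ := h
      exact hW.pair_mem_pw hU (ZFSet.mem_union.2 (Or.inr (mem_pw.2 ⟨hs, hsX⟩)))
        (ZFSet.mem_union.2 (Or.inl (hsX hz)))
    have hyF : y ∈ F := (hmF y).2 ⟨⟨hy, ZFSet.sep_subset⟩, s, ⟨hs, hsX⟩, hne,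
      fun e he => (hmy e).1 he, fun z hz => (hmy _).2 ⟨z, hz, rfl⟩⟩
    obtain ⟨e, ⟨he, hec⟩, hu⟩ := hc1 y hyF
    obtain ⟨z, hz, rfl⟩ := (hmy e).1 he
    refine ⟨z, ⟨hz, hec⟩, fun w hw => ?_⟩
    exact (ZFSet.pair_inj.1 (hu _ ⟨(hmy _).2 ⟨w, hw.1, rfl⟩, hw.2⟩)).2)
  exact ⟨τ, g, hg, fun i hi => (ZFSet.mem_sep.1 (h1 i hi).1).1, h2⟩

end IsTransitiveModel

/-! ### Ladders -/

/-- `h` is a strictly increasing cofinal map from `τ` to `α`. -/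
structure IsLadder (h : Ordinal.{u} → Ordinal.{u}) (τ α : Ordinal.{u}) : Prop where
  strictMono : StrictMonoOn h (Set.Iio τ)
  lt : ∀ i < τ, h i < α
  cofinal : ∀ β < α, ∃ i < τ, β < h i

/-- The model `W` contains a strictly increasing cofinal map from `τ` to `α`. -/
def HasLadder (W : Class.{u}) (τ α : Ordinal.{u}) : Prop :=
  ∃ h, W (ograph τ h) ∧ IsLadder h τ α

/-- The set `f` is a strictly increasing cofinal map from `τ` to `α`. -/
def IsLadderSet (f τ α : ZFSet.{u}) : Prop :=
  (∀ e ∈ f, ∃ i ∈ τ, ∃ a ∈ α, e = ZFSet.pair i a) ∧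
    (∀ i ∈ τ, ∃ a ∈ α, ZFSet.pair i a ∈ f) ∧
    (∀ i ∈ τ, ∀ a ∈ α, ∀ b ∈ α, ZFSet.pair i a ∈ f → ZFSet.pair i b ∈ f → a = b) ∧
    (∀ i ∈ τ, ∀ k ∈ τ, ∀ a ∈ α, ∀ b ∈ α, ZFSet.pair i a ∈ f → ZFSet.pair k b ∈ f → i ∈ k → a ∈ b) ∧
    ∀ b ∈ α, ∃ i ∈ τ, ∃ a ∈ α, ZFSet.pair i a ∈ f ∧ b ∈ a

theorem D0.isLadderSet {α : Type} {n : ℕ} {p q r : Ctx.{u} α n → ZFSet.{u}} (hp : IsVar p)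
    (hq : IsVar q) (hr : IsVar r) : D0 fun c => IsLadderSet (p c) (q c) (r c) :=
  .and (.ball hp <| .bex hq.pop <| .bex hr.pop.pop <|
      .eq_pair IsVar.top.pop.pop IsVar.top.pop .top) <|
    .and (.ball hq <| .bex hr.pop <| .pair_mem IsVar.top.pop .top hp.pop.pop) <|
    .and (.ball hq <| .ball hr.pop <| .ball hr.pop.pop <|
      .imp (.pair_mem IsVar.top.pop.pop IsVar.top.pop hp.pop.pop.pop) <|
      .imp (.pair_mem IsVar.top.pop.pop IsVar.top hp.pop.pop.pop) <| .eq IsVar.top.pop .top) <|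
    .and (.ball hq <| .ball hq.pop <| .ball hr.pop.pop <| .ball hr.pop.pop.pop <|
      .imp (.pair_mem IsVar.top.pop.pop.pop IsVar.top.pop hp.pop.pop.pop.pop) <|
      .imp (.pair_mem IsVar.top.pop.pop IsVar.top hp.pop.pop.pop.pop) <|
      .imp (.mem IsVar.top.pop.pop.pop IsVar.top.pop.pop) <| .mem IsVar.top.pop .top) <|
    .ball hr <| .bex hq.pop <| .bex hr.pop.pop <|
      .and (.pair_mem IsVar.top.pop .top hp.pop.pop.pop) <| .mem IsVar.top.pop.pop .top

theorem forall_mem_toZFSet {o : Ordinal.{u}} {p : ZFSet.{u} → Prop} :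
    (∀ z ∈ o.toZFSet, p z) ↔ ∀ a < o, p a.toZFSet := by
  simp [Ordinal.mem_toZFSet_iff]

theorem exists_mem_toZFSet {o : Ordinal.{u}} {p : ZFSet.{u} → Prop} :
    (∃ z ∈ o.toZFSet, p z) ↔ ∃ a < o, p a.toZFSet := by
  simp [Ordinal.mem_toZFSet_iff]

/-- A total and functional relation between ordinals is the graph of a function. -/
theorem eq_ograph {f : ZFSet.{u}} {τ α : Ordinal.{u}}
    (h1 : ∀ e ∈ f, ∃ i < τ, ∃ a < α, e = ZFSet.pair i.toZFSet a.toZFSet)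
    (h2 : ∀ i < τ, ∃ a < α, ZFSet.pair i.toZFSet a.toZFSet ∈ f)
    (h3 : ∀ i < τ, ∀ a < α, ∀ b < α, ZFSet.pair i.toZFSet a.toZFSet ∈ f →
      ZFSet.pair i.toZFSet b.toZFSet ∈ f → a = b) :
    ∃ h, f = ograph τ h ∧ ∀ i < τ, h i < α := by
  choose! h hh hf using h2
  refine ⟨h, ?_, hh⟩
  ext e
  rw [mem_graph]
  constructor
  · intro he
    obtain ⟨i, hi, a, ha, rfl⟩ := h1 e he
    exact ⟨i, hi, by rw [h3 i hi a ha _ (hh i hi) he (hf i hi)]⟩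
  · rintro ⟨i, hi, rfl⟩
    exact hf i hi

theorem isLadderSet_iff {f : ZFSet.{u}} {τ α : Ordinal.{u}} :
    IsLadderSet f τ.toZFSet α.toZFSet ↔ ∃ h, f = ograph τ h ∧ IsLadder h τ α := by
  simp only [IsLadderSet, forall_mem_toZFSet, exists_mem_toZFSet,
    Ordinal.toZFSet_mem_toZFSet_iff, Ordinal.toZFSet_injective.eq_iff]
  constructor
  · rintro ⟨h1, h2, h3, h4, h5⟩
    obtain ⟨h, rfl, hlt⟩ := eq_ograph h1 h2 h3
    refine ⟨h, rfl, ⟨fun i hi k hk hik => ?_, hlt, fun β hβ => ?_⟩⟩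
    · exact h4 i hi k hk _ (hlt i hi) _ (hlt k hk) (pair_mem_ograph.2 ⟨hi, rfl⟩)
        (pair_mem_ograph.2 ⟨hk, rfl⟩) hik
    · obtain ⟨i, hi, a, ha, hp, hb⟩ := h5 β hβ
      obtain ⟨_, rfl⟩ := pair_mem_ograph.1 hp
      exact ⟨i, hi, hb⟩
  · rintro ⟨h, rfl, hl⟩
    refine ⟨fun e he => ?_, fun i hi => ⟨h i, hl.lt i hi, pair_mem_ograph.2 ⟨hi, rfl⟩⟩, ?_, ?_, ?_⟩
    · obtain ⟨i, hi, rfl⟩ := mem_graph.1 he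
      exact ⟨i, hi, _, hl.lt i hi, rfl⟩
    · intro i hi a _ b _ ha hb
      rw [(pair_mem_ograph.1 ha).2, (pair_mem_ograph.1 hb).2]
    · intro i hi k hk a _ b _ ha hb hik
      rw [(pair_mem_ograph.1 ha).2, (pair_mem_ograph.1 hb).2]
      exact hl.strictMono hi hk hik
    · intro b hb
      obtain ⟨i, hi, h'⟩ := hl.cofinal b hb
      exact ⟨i, hi, _, hl.lt i hi, pair_mem_ograph.2 ⟨hi, rfl⟩, h'⟩

/-! ### Regularity in a model -/

theorem IsTransitiveModel.isRegularIn_iff {W : Class.{u}} (hW : IsTransitiveModel W)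
    {ν : Ordinal.{u}} :
    IsRegularIn W ν.toZFSet ↔ 0 < ν ∧ (∀ a < ν, ∃ b < ν, a < b) ∧
      ∀ a < ν, ∀ h : Ordinal.{u} → Ordinal.{u}, W (ograph a h) → (∀ i < a, h i < ν) →
        ∃ γ < ν, ∀ i < a, h i < γ := by
  have hne : ν.toZFSet.Nonempty ↔ 0 < ν := by
    constructor
    · rintro ⟨z, hz⟩
      obtain ⟨a, ha, _⟩ := Ordinal.mem_toZFSet_iff.1 hz
      exact pos_of_gt ha
    · intro h
      exact ⟨_, Ordinal.toZFSet_mem_toZFSet_iff.2 h⟩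
  unfold IsRegularIn
  rw [hne, and_iff_right (hW.toZFSet ν), and_iff_right (ZFSet.isOrdinal_toZFSet ν)]
  simp only [forall_mem_toZFSet, exists_mem_toZFSet, Ordinal.toZFSet_mem_toZFSet_iff]
  refine and_congr_right fun _ => and_congr_right fun _ => forall_congr' fun a =>
    forall_congr' fun ha => ?_
  constructor
  · intro H h hh hlt
    obtain ⟨γ, hγ, h2⟩ := H _ hh (by
      refine ⟨fun e he => ?_, fun z hz => ?_⟩
      · obtain ⟨i, hi, rfl⟩ := mem_graph.1 he
        exact ZFSet.pair_mem_prod.2 ⟨Ordinal.toZFSet_mem_toZFSet_iff.2 hi,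
          Ordinal.toZFSet_mem_toZFSet_iff.2 (hlt i hi)⟩
      · obtain ⟨i, hi, rfl⟩ := Ordinal.mem_toZFSet_iff.1 hz
        exact ⟨_, toZFSet_pair_mem_graph.2 ⟨hi, rfl⟩, fun w hw => (toZFSet_pair_mem_graph.1 hw).2⟩)
    refine ⟨γ, hγ, fun i hi => ?_⟩
    exact Ordinal.toZFSet_mem_toZFSet_iff.1 (h2 i hi _ (pair_mem_ograph.2 ⟨hi, rfl⟩))
  · intro H f hf hfun
    obtain ⟨h, rfl, hlt⟩ := eq_ograph (f := f) (τ := a) (α := ν)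
      (fun e he => by
        obtain ⟨x, hx, y, hy, rfl⟩ := ZFSet.mem_prod.1 (hfun.1 he)
        obtain ⟨i, hi, rfl⟩ := Ordinal.mem_toZFSet_iff.1 hx
        obtain ⟨b, hb, rfl⟩ := Ordinal.mem_toZFSet_iff.1 hy
        exact ⟨i, hi, b, hb, rfl⟩)
      (fun i hi => by
        obtain ⟨y, hy, _⟩ := hfun.2 _ (Ordinal.toZFSet_mem_toZFSet_iff.2 hi)
        obtain ⟨b, hb, rfl⟩ := Ordinal.mem_toZFSet_iff.1 (ZFSet.pair_mem_prod.1 (hfun.1 hy)).2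
        exact ⟨b, hb, hy⟩)
      (fun i hi b _ b' _ h h' => Ordinal.toZFSet_injective
        ((hfun.2 _ (Ordinal.toZFSet_mem_toZFSet_iff.2 hi)).unique h h'))
    obtain ⟨γ, hγ, h2⟩ := H h hf hlt
    refine ⟨γ, hγ, fun i hi β hβ => ?_⟩
    obtain ⟨_, rfl⟩ := toZFSet_pair_mem_graph.1 hβ
    exact Ordinal.toZFSet_mem_toZFSet_iff.2 (h2 i hi)

/-! ### Closed unbounded sets of ordinals -/

/-- `D ∩ ν` is closed and unbounded in `ν`. -/
def IsClubBelow (ν : Ordinal.{u}) (D : Set Ordinal.{u}) : Prop :=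
  (∀ a < ν, ∃ b ∈ D, b < ν ∧ a < b) ∧
    ∀ γ < ν, 0 < γ → (∀ a < γ, ∃ b ∈ D, b < γ ∧ a < b) → γ ∈ D

theorem IsClubBelow.isClubIn {ν : Ordinal.{u}} {D : Set Ordinal.{u}} (h : IsClubBelow ν D) :
    IsClubIn ν.toZFSet (ZFSet.sep (fun z => z.rank ∈ D) ν.toZFSet) := by
  refine ⟨ZFSet.sep_subset, ?_, ?_⟩
  · rw [forall_mem_toZFSet]
    intro a ha
    obtain ⟨b, hb, hbν, hab⟩ := h.1 a ha
    refine ⟨b.toZFSet, ?_, Ordinal.toZFSet_mem_toZFSet_iff.2 hab⟩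
    rw [ZFSet.mem_sep, Ordinal.toZFSet_mem_toZFSet_iff, Ordinal.rank_toZFSet]
    exact ⟨hbν, hb⟩
  · rw [forall_mem_toZFSet]
    intro γ hγ hne hub
    rw [ZFSet.mem_sep, Ordinal.toZFSet_mem_toZFSet_iff, Ordinal.rank_toZFSet]
    refine ⟨hγ, h.2 γ hγ ?_ fun a ha => ?_⟩
    · obtain ⟨z, hz⟩ := hne
      obtain ⟨a, ha, _⟩ := Ordinal.mem_toZFSet_iff.1 hz
      exact pos_of_gt ha
    · obtain ⟨b, hb, hbγ, hab⟩ := hub _ (Ordinal.toZFSet_mem_toZFSet_iff.2 ha)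
      obtain ⟨b, hb', rfl⟩ := Ordinal.mem_toZFSet_iff.1 hbγ
      rw [ZFSet.mem_sep, Ordinal.rank_toZFSet] at hb
      exact ⟨b, hb.2, hb', Ordinal.toZFSet_mem_toZFSet_iff.1 hab⟩

theorem IsClubIn.isClubBelow {ν : Ordinal.{u}} {C : ZFSet.{u}} (h : IsClubIn ν.toZFSet C) :
    IsClubBelow ν {a | a.toZFSet ∈ C} := by
  obtain ⟨hs, h1, h2⟩ := h
  constructor
  · intro a ha
    obtain ⟨β, hβ, hab⟩ := h1 _ (Ordinal.toZFSet_mem_toZFSet_iff.2 ha)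
    obtain ⟨b, hb, rfl⟩ := Ordinal.mem_toZFSet_iff.1 (hs hβ)
    exact ⟨b, hβ, hb, Ordinal.toZFSet_mem_toZFSet_iff.1 hab⟩
  · intro γ hγ h0 hub
    refine h2 _ (Ordinal.toZFSet_mem_toZFSet_iff.2 hγ)
      ⟨_, Ordinal.toZFSet_mem_toZFSet_iff.2 h0⟩ ?_
    rw [forall_mem_toZFSet]
    intro a ha
    obtain ⟨b, hb, hbγ, hab⟩ := hub a ha
    exact ⟨_, hb, Ordinal.toZFSet_mem_toZFSet_iff.2 hbγ, Ordinal.toZFSet_mem_toZFSet_iff.2 hab⟩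

theorem IsStationaryIn.exists_mem {ν : Ordinal.{u}} {S : ZFSet.{u}}
    (hS : IsStationaryIn Class.univ ν.toZFSet S) {D : Set Ordinal.{u}} (hD : IsClubBelow ν D) :
    ∃ a < ν, a ∈ D ∧ a.toZFSet ∈ S := by
  obtain ⟨β, hβ, h⟩ := hS.2 _ trivial hD.isClubIn
  obtain ⟨h1, h2⟩ := ZFSet.mem_sep.1 h
  obtain ⟨a, ha, rfl⟩ := Ordinal.mem_toZFSet_iff.1 h1
  rw [Ordinal.rank_toZFSet] at h2
  exact ⟨a, ha, h2, hβ⟩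

/-! ### Cofinalities -/

theorem exists_bound_of_card_lt_cof {a ν : Ordinal.{u}} (h : a.card < ν.cof)
    {f : Ordinal.{u} → Ordinal.{u}} (hf : ∀ i < a, f i < ν) : ∃ γ < ν, ∀ i < a, f i ≤ γ := by
  let e : Set.Iio a ≃ Shrink.{u, u + 1} (Set.Iio a) := equivShrink _
  let F : Shrink.{u, u + 1} (Set.Iio a) → Ordinal.{u} := fun i => f (e.symm i).1
  refine ⟨⨆ i, F i, Ordinal.iSup_lt_of_lt_cof ?_ fun i => hf _ (e.symm i).2, fun i hi => ?_⟩
  · convert h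
    rw [← Cardinal.lift_inj.{u, u + 1}, ← Cardinal.mk_Iio_ordinal]
    exact (Cardinal.lift_mk_shrink' (Set.Iio a)).trans (Cardinal.lift_id'.{u, u + 1} _)
  · have := Ordinal.le_iSup F (e ⟨i, hi⟩)
    simpa [F] using this

theorem IsLadder.cof_eq {h : Ordinal.{u} → Ordinal.{u}} {τ α : Ordinal.{u}} (hl : IsLadder h τ α) :
    α.cof = τ.cof := by
  have hs : StrictMono fun i : Set.Iio τ => h i := fun i k hik => hl.strictMono i.2 k.2 hik
  rw [← Ordinal.cof_iSup_Iio_add_one hs]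
  congr 1
  refine le_antisymm (le_of_forall_lt fun β hβ => ?_) ?_
  · obtain ⟨i, hi, hb⟩ := hl.cofinal β hβ
    exact Ordinal.lt_iSup_iff.2 ⟨⟨i, hi⟩, hb.trans (Order.lt_add_one_iff.2 le_rfl)⟩
  · exact Ordinal.iSup_le fun i => Order.add_one_le_of_lt (hl.lt _ i.2)

theorem exists_isLadder {ν : Ordinal.{u}} (hν : Order.IsSuccLimit ν) :
    ∃ h, IsLadder h ν.cof.ord ν := by
  obtain ⟨f, hf⟩ := Ordinal.exists_isFundamentalSeq (o := ν) rfl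
  refine ⟨fun i => if hi : i < ν.cof.ord then f ⟨i, hi⟩ else 0, ⟨?_, ?_, ?_⟩⟩
  · intro i hi k hk hik
    simp only [Set.mem_Iio] at hi hk
    simp only [hi, hk, dif_pos]
    exact hf.strictMono hik
  · intro i hi
    simp only [hi, dif_pos]
    exact (f ⟨i, hi⟩).2
  · intro β hβ
    obtain ⟨_, ⟨i, rfl⟩, hi⟩ := hf.isCofinal_range ⟨β + 1, hν.add_one_lt hβ⟩
    refine ⟨i, i.2, ?_⟩
    have : i.1 < ν.cof.ord := i.2
    simp only [this, dif_pos]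
    exact (Order.lt_add_one_iff.2 le_rfl).trans_le hi

theorem le_of_strictMonoOn_Iio {f : Ordinal.{u} → Ordinal.{u}} {σ : Ordinal.{u}}
    (hf : StrictMonoOn f (Set.Iio σ)) (i : Ordinal.{u}) (hi : i < σ) : i ≤ f i := by
  induction i using WellFoundedLT.induction with
  | _ i ih =>
    refine le_of_forall_lt fun k hk => ?_
    exact (ih k hk (hk.trans hi)).trans_lt (hf (hk.trans hi) hi hk)

theorem isSuccLimit_of_aleph0_le_cof {α : Ordinal.{u}} (h : Cardinal.aleph0 ≤ α.cof) :
    Order.IsSuccLimit α :=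
  Ordinal.one_lt_cof_iff.1 (Ordinal.aleph0_le_cof_iff.1 h)

/-! ### Cofinalities in stationary correct models -/

namespace IsTransitiveModel

variable {W : Class.{u}}

theorem isRegularIn_ord (hW : IsTransitiveModel W) {μ : Cardinal.{u}} (hμ : μ.IsRegular) :
    IsRegularIn W μ.ord.toZFSet := by
  have hl : Order.IsSuccLimit μ.ord := isSuccLimit_of_aleph0_le_cof (hμ.cof_ord.symm ▸ hμ.aleph0_le)
  refine hW.isRegularIn_iff.2 ⟨hμ.ord_pos, fun a ha => ⟨a + 1, hl.add_one_lt ha, by simp⟩,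
    fun a ha h _ hh => ?_⟩
  obtain ⟨γ, hγ, hb⟩ := exists_bound_of_card_lt_cof (ν := μ.ord)
    (by rw [hμ.cof_ord]; exact Cardinal.lt_ord.1 ha) hh
  exact ⟨γ + 1, hl.add_one_lt hγ, fun i hi => Order.lt_add_one_iff.2 (hb i hi)⟩

theorem ograph_restrict (hW : IsTransitiveModel W) {σ τ ν : Ordinal.{u}} {h : Ordinal.{u} → Ordinal.{u}}
    (hh : W (ograph σ h)) (hτ : τ ≤ σ) (hν : ∀ i < τ, h i < ν) : W (ograph τ h) := by
  refine hW.graph_mem ![⟨_, hW.toZFSet τ⟩, ⟨_, hW.toZFSet ν⟩, ⟨_, hh⟩] 0 1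
    (Q := fun v i y => ZFSet.pair i y ∈ v 2) (.pair_mem IsVar.top.pop .top (.fv _)) rfl ?_
  intro i hi y
  change y ∈ ν.toZFSet ∧ ZFSet.pair _ _ ∈ ograph σ h ↔ _
  rw [toZFSet_pair_mem_graph]
  constructor
  · rintro ⟨_, _, h⟩
    exact h
  · rintro rfl
    exact ⟨Ordinal.toZFSet_mem_toZFSet_iff.2 (hν i hi), hi.trans_le hτ, rfl⟩

/-- The set of the ordinals below `ν` which have a ladder of length `τ` in the model. -/
theorem exists_ladder_set (hW : IsTransitiveModel W) (τ ν : Ordinal.{u}) (hτ : τ ≤ ν) :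
    ∃ S, W S ∧ S ⊆ ν.toZFSet ∧ ∀ α : Ordinal.{u}, α.toZFSet ∈ S ↔ α < ν ∧ HasLadder W τ α := by
  have hν := hW.toZFSet ν
  refine ⟨_, hW.sep ![⟨_, hW.toZFSet τ⟩, ⟨_, hW.pw (hW.pw (hW.pw hν))⟩]
    (R := fun c => ∃ f ∈ c.1 1, IsLadderSet f (c.1 0) c.top)
    (.bex (.fv _) <| .isLadderSet .top (.fv _) IsVar.top.pop) hν, ZFSet.sep_subset, fun α => ?_⟩
  rw [ZFSet.mem_sep, Ordinal.toZFSet_mem_toZFSet_iff]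
  refine and_congr_right fun hα => ?_
  change (∃ f ∈ InnerModel.pw W (InnerModel.pw W (InnerModel.pw W ν.toZFSet)),
    IsLadderSet f τ.toZFSet α.toZFSet) ↔ _
  simp only [isLadderSet_iff]
  constructor
  · rintro ⟨f, hf, h, rfl, hl⟩
    exact ⟨h, (mem_pw.1 hf).1, hl⟩
  · rintro ⟨h, hh, hl⟩
    refine ⟨_, hW.graph_mem_pw hν (Ordinal.toZFSet_subset_toZFSet_iff.2 hτ) (fun i hi => ?_) hh,
      h, rfl, hl⟩
    exact Ordinal.toZFSet_mem_toZFSet_iff.2 ((hl.lt i hi).trans hα)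

/-- If `W` is stationary correct at its regular cardinal `ν` and `τ < ν`, then every club in `ν`
contains an ordinal which has a ladder of length `τ` in `W`. -/
theorem exists_hasLadder_mem_club (hW : IsTransitiveModel W) {τ ν : Ordinal.{u}}
    (hreg : IsRegularIn W ν.toZFSet) (hcor : StationaryCorrectAt W ν.toZFSet) (hτ : τ < ν)
    (hlim : Order.IsSuccLimit τ) {D : Set Ordinal.{u}} (hD : IsClubBelow ν D) :
    ∃ α < ν, α ∈ D ∧ HasLadder W τ α := by
  obtain ⟨S, hS, hSν, hmS⟩ := hW.exists_ladder_set τ ν hτ.le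
  obtain ⟨_, _, hbd⟩ := hW.isRegularIn_iff.1 hreg
  have hst : IsStationaryIn W ν.toZFSet S := by
    refine ⟨hSν, fun C hC hclub => ?_⟩
    have hC' := hclub.isClubBelow
    obtain ⟨σ, h, hh, hmono, hen⟩ := hW.exists_strictMono_enum hC fun z hz =>
      (ZFSet.isOrdinal_toZFSet ν).mem (hclub.1 hz)
    have hlt : ∀ i < σ, h i < ν := fun i hi =>
      Ordinal.toZFSet_mem_toZFSet_iff.1 (hclub.1 ((hen _).2 ⟨i, hi, rfl⟩))
    -- The club has order type at least `ν`, since a shorter enumeration would be bounded by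
    -- regularity in `W`.
    have hσ : ν ≤ σ := by
      by_contra! hσ
      obtain ⟨γ, hγ, hb⟩ := hbd σ hσ h hh hlt
      obtain ⟨b, hb', _, hlt'⟩ := hC'.1 γ hγ
      obtain ⟨i, hi, rfl⟩ := (hen b).1 hb'
      exact (hb i hi).not_gt hlt'
    have hτσ := hτ.trans_le hσ
    -- The supremum of the first `τ` elements of the club lies in the club, and the enumeration
    -- restricted to `τ` is a ladder for it.
    obtain ⟨α, hα, hmin⟩ := WellFounded.has_min (wellFounded_lt (α := Ordinal.{u}))
      {α | ∀ i < τ, h i < α} ⟨h τ, fun i hi => hmono (hi.trans hτσ) hτσ hi⟩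
    have hαν : α < ν :=
      (not_lt.1 (hmin (h τ) fun i hi => hmono (hi.trans hτσ) hτσ hi)).trans_lt (hlt τ hτσ)
    have hlad : IsLadder h τ α := by
      refine ⟨hmono.mono (Set.Iio_subset_Iio hτσ.le), hα, fun β hβ => ?_⟩
      have : ¬ ∀ i < τ, h i < β := fun hlt => hmin β hlt hβ
      push Not at this
      obtain ⟨i, hi, hle⟩ := this
      have hi1 := hlim.add_one_lt hi
      exact ⟨i + 1, hi1, hle.trans_lt (hmono (hi.trans hτσ) (hi1.trans hτσ) (by simp))⟩
    refine ⟨α.toZFSet, (hmS α).2 ⟨hαν, h, hW.ograph_restrict hh hτσ.le fun i hi =>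
      hlt i (hi.trans hτσ), hlad⟩, hC'.2 α hαν ?_ fun a ha => ?_⟩
    · exact pos_of_gt (hα 0 hlim.bot_lt)
    · obtain ⟨i, hi, h'⟩ := hlad.cofinal a ha
      exact ⟨h i, (hen _).2 ⟨i, hi.trans hτσ, rfl⟩, hα i hi, h'⟩
  obtain ⟨α, hα, hαD, hαS⟩ := (hcor S hS hst).exists_mem hD
  exact ⟨α, hα, hαD, ((hmS α).1 hαS).2⟩

/-- If `ν.cof ≤ μ`, build a club from a cofinal sequence of length `ν.cof`. By correctness it
contains a point with a ladder of length `μ`. Such a point has cofinality `μ`, yet it is a limit of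
fewer than `μ` terms of the sequence. -/
theorem lt_cof_of_stationaryCorrectAt (hW : IsTransitiveModel W) {ν : Ordinal.{u}}
    (hreg : IsRegularIn W ν.toZFSet) (hcor : StationaryCorrectAt W ν.toZFSet) {μ : Cardinal.{u}}
    (hμ : μ.IsRegular) (hμν : μ.ord < ν) : μ < ν.cof := by
  by_contra! hle
  obtain ⟨h0, h1, _⟩ := hW.isRegularIn_iff.1 hreg
  have hν : Order.IsSuccLimit ν := by
    refine Ordinal.isSuccLimit_iff.2 ⟨h0.ne', Order.isSuccPrelimit_of_succ_lt fun a ha => ?_⟩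
    obtain ⟨b, hb, hab⟩ := h1 a ha
    exact (Order.succ_le_of_lt hab).trans_lt hb
  obtain ⟨h, hl⟩ := exists_isLadder hν
  -- The limits of the sequence may be bounded in `ν` (when the cofinality is `ω`), so the
  -- successors `h i + 1` are added; these have no ladder of limit length.
  let D : Set Ordinal.{u} := {γ | (∃ i < ν.cof.ord, γ = h i + 1) ∨
    ∀ a < γ, ∃ i < ν.cof.ord, a < h i ∧ h i < γ}
  have hD : IsClubBelow ν D := by
    constructor
    · intro a ha
      obtain ⟨i, hi, hai⟩ := hl.cofinal a ha
      exact ⟨h i + 1, Or.inl ⟨i, hi, rfl⟩, hν.add_one_lt (hl.lt i hi), hai.trans (by simp)⟩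
    · intro γ hγ _ hub
      refine Or.inr fun a ha => ?_
      obtain ⟨b, _, hbγ, hab⟩ := hub a ha
      obtain ⟨c, hc, hcγ, hbc⟩ := hub b hbγ
      rcases hc with ⟨i, hi, rfl⟩ | hc
      · exact ⟨i, hi, hab.trans_le (Order.lt_add_one_iff.1 hbc), lt_trans (by simp) hcγ⟩
      · obtain ⟨i, hi, hbi, hic⟩ := hc b hbc
        exact ⟨i, hi, hab.trans hbi, hic.trans hcγ⟩
  have hμl : Order.IsSuccLimit μ.ord :=
    isSuccLimit_of_aleph0_le_cof (hμ.cof_ord.symm ▸ hμ.aleph0_le)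
  obtain ⟨α, hα, hαD, g, _, hg⟩ := hW.exists_hasLadder_mem_club hreg hcor hμν hμl hD
  have hlim : ∀ a < α, ∃ i < ν.cof.ord, a < h i ∧ h i < α := by
    rcases hαD with ⟨i, hi, rfl⟩ | h
    · obtain ⟨k, hk, hik⟩ := hg.cofinal (h i) (by simp)
      exact absurd (hg.lt k hk) (not_lt.2 (Order.add_one_le_of_lt hik))
    · exact h
  have hα0 : 0 < α := pos_of_gt (hg.lt 0 hμl.bot_lt)
  -- All terms of the sequence below `α` have index below `i₀`, which has fewer than `μ` elements.
  obtain ⟨i₀, hi₀, hαi⟩ := hl.cofinal α hα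
  have hcard : i₀.card < α.cof := by
    rw [hg.cof_eq, hμ.cof_ord]
    exact (Cardinal.lt_ord.1 hi₀).trans_le hle
  obtain ⟨γ, hγ, hb⟩ := exists_bound_of_card_lt_cof (f := fun i => if h i < α then h i else 0) hcard
    (fun i _ => by
      split_ifs with hi
      exacts [hi, hα0])
  obtain ⟨i, hi, hγi, hiα⟩ := hlim γ hγ
  have hii : i < i₀ := (hl.strictMono.lt_iff_lt hi hi₀).1 (hiα.trans hαi)
  have := hb i hii
  rw [if_pos hiα] at this
  exact this.not_gt hγi

theorem ograph_id_mem (hW : IsTransitiveModel W) (α : Ordinal.{u}) : W (ograph α id) := by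
  refine hW.graph_mem ![⟨_, hW.toZFSet α⟩] 0 0 (Q := fun _ i y => y = i)
    (.eq .top IsVar.top.pop) rfl fun i hi y => ?_
  change y ∈ α.toZFSet ∧ y = i.toZFSet ↔ _
  refine ⟨fun h => h.2, ?_⟩
  rintro rfl
  exact ⟨Ordinal.toZFSet_mem_toZFSet_iff.2 hi, rfl⟩

/-- The least length of a ladder for `α` in `W` is a regular cardinal of `W`. -/
theorem isRegularIn_of_forall_le (hW : IsTransitiveModel W) {ν α : Ordinal.{u}}
    (hα : Order.IsSuccLimit α) (hν : HasLadder W ν α) (hmin : ∀ σ, HasLadder W σ α → ν ≤ σ) :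
    IsRegularIn W ν.toZFSet := by
  obtain ⟨h, hh, hl⟩ := hν
  have hνl : Order.IsSuccLimit ν := by
    rw [← Ordinal.one_lt_cof_iff, ← hl.cof_eq]
    exact Ordinal.one_lt_cof_iff.2 hα
  refine hW.isRegularIn_iff.2 ⟨hνl.bot_lt, fun a ha => ⟨a + 1, hνl.add_one_lt ha, by simp⟩, ?_⟩
  intro a ha f hf hfν
  by_contra! hunb
  -- the values of the ladder at the records of `f`
  obtain ⟨X, hX, hmX⟩ : ∃ X, W X ∧ ∀ z, z ∈ X ↔ ∃ i < a, (∀ k < i, f k < f i) ∧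
      z = (h (f i)).toZFSet := by
    refine ⟨_, hW.sep ![⟨_, hW.toZFSet a⟩, ⟨_, hW.toZFSet ν⟩, ⟨_, hf⟩, ⟨_, hh⟩]
      (R := fun c => ∃ i ∈ c.1 0, ∃ b ∈ c.1 1, ZFSet.pair i b ∈ c.1 2 ∧
        (∀ k ∈ i, ∀ d ∈ c.1 1, ZFSet.pair k d ∈ c.1 2 → d ∈ b) ∧ ZFSet.pair b c.top ∈ c.1 3)
      (.bex (.fv _) <| .bex (.fv _) <| .and (.pair_mem IsVar.top.pop .top (.fv _)) <| .and
        (.ball IsVar.top.pop <| .ball (.fv _) <| .imp (.pair_mem IsVar.top.pop .top (.fv _))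
          (.mem .top IsVar.top.pop.pop)) <| .pair_mem .top IsVar.top.pop.pop (.fv _))
      (hW.toZFSet α), fun z => ?_⟩
    rw [ZFSet.mem_sep]
    change (z ∈ α.toZFSet ∧ ∃ i ∈ a.toZFSet, ∃ b ∈ ν.toZFSet, ZFSet.pair i b ∈ ograph a f ∧
      (∀ k ∈ i, ∀ d ∈ ν.toZFSet, ZFSet.pair k d ∈ ograph a f → d ∈ b) ∧
      ZFSet.pair b z ∈ ograph ν h) ↔ _
    simp only [exists_mem_toZFSet, forall_mem_toZFSet, toZFSet_pair_mem_graph,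
      Ordinal.toZFSet_mem_toZFSet_iff, Ordinal.toZFSet_injective.eq_iff]
    constructor
    · rintro ⟨_, i, hi, b, hb, ⟨_, rfl⟩, hrec, _, rfl⟩
      exact ⟨i, hi, fun k hk => hrec k hk _ (hfν k (hk.trans hi)) ⟨hk.trans hi, rfl⟩, rfl⟩
    · rintro ⟨i, hi, hrec, rfl⟩
      refine ⟨Ordinal.toZFSet_mem_toZFSet_iff.2 (hl.lt _ (hfν i hi)), i, hi, f i, hfν i hi,
        ⟨hi, rfl⟩, ?_, hfν i hi, rfl⟩
      rintro k hk d _ ⟨_, rfl⟩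
      exact hrec k hk
  obtain ⟨σ, e, he, hmono, hen⟩ := hW.exists_strictMono_enum hX fun z hz => by
    obtain ⟨i, _, _, rfl⟩ := (hmX z).1 hz
    exact ZFSet.isOrdinal_toZFSet _
  have hen' : ∀ β, (∃ i < σ, e i = β) ↔ ∃ i < a, (∀ k < i, f k < f i) ∧ β = h (f i) := by
    intro β
    rw [← hen, hmX]
    simp only [Ordinal.toZFSet_injective.eq_iff]
  have hlad : IsLadder e σ α := by
    refine ⟨hmono, fun i hi => ?_, fun β hβ => ?_⟩
    · obtain ⟨k, hk, _, h'⟩ := (hen' _).1 ⟨i, hi, rfl⟩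
      rw [h']
      exact hl.lt _ (hfν k hk)
    · obtain ⟨m, hm, hβm⟩ := hl.cofinal β hβ
      -- The least index at which `f` reaches `m` is a record, so the values at records are still
      -- cofinal.
      obtain ⟨i, ⟨hi, hmi⟩, himin⟩ := WellFounded.has_min (wellFounded_lt (α := Ordinal.{u}))
        {i | i < a ∧ m ≤ f i} (hunb m hm)
      have hrec : ∀ k < i, f k < f i := by
        intro k hk
        by_contra! hle
        exact himin k ⟨hk.trans hi, hmi.trans hle⟩ hk
      obtain ⟨k, hk, hek⟩ := (hen' (h (f i))).2 ⟨i, hi, hrec, rfl⟩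
      refine ⟨k, hk, ?_⟩
      rw [hek]
      exact hβm.trans_le (hl.strictMono.monotoneOn hm (hfν i hi) hmi)
  have hσ := hmin σ ⟨e, he, hlad⟩
  -- `r η` is the record of `f` that yields the value `e η`. It is strictly increasing from `σ` into
  -- `a`, contradicting `a < ν ≤ σ`.
  have hr : ∀ η, ∃ i, η < σ → i < a ∧ (∀ k < i, f k < f i) ∧ e η = h (f i) := by
    intro η
    by_cases hη : η < σ
    · obtain ⟨i, hi⟩ := (hen' _).1 ⟨η, hη, rfl⟩
      exact ⟨i, fun _ => hi⟩
    · exact ⟨0, fun h => absurd h hη⟩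
  choose r hr using hr
  have hrm : StrictMonoOn r (Set.Iio σ) := by
    intro η hη ζ hζ hlt
    obtain ⟨h1, h2, h3⟩ := hr η hη
    obtain ⟨h1', h2', h3'⟩ := hr ζ hζ
    have := hmono hη hζ hlt
    rw [h3, h3', hl.strictMono.lt_iff_lt (hfν _ h1) (hfν _ h1')] at this
    by_contra! hle
    rcases hle.eq_or_lt with h | h
    · rw [h] at this
      exact lt_irrefl _ this
    · exact this.not_gt (h2 _ h)
  have haσ := ha.trans_le hσ
  exact (le_of_strictMonoOn_Iio hrm a haσ).not_gt (hr a haσ).1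

/-- If the cofinality of `α` is large, then it is computed correctly by a stationary correct
model. -/
theorem hasLadder_of_cof_eq (hW : IsTransitiveModel W) {θ : Ordinal.{u}}
    (hθ : ∀ δ, IsRegularIn W δ → θ.toZFSet ∈ δ → StationaryCorrectAt W δ) {μ : Cardinal.{u}}
    (hμ : μ.IsRegular) (hμθ : θ < μ.ord) {α : Ordinal.{u}} (hα : α.cof = μ) :
    HasLadder W μ.ord α := by
  have hαl : Order.IsSuccLimit α := isSuccLimit_of_aleph0_le_cof (hα ▸ hμ.aleph0_le)
  -- The identity is a ladder, so there is a least length `ν`. It is regular in `W` and has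
  -- cofinality `μ`; if it were above `μ`, correctness at `ν` would make its cofinality exceed `μ`.
  obtain ⟨ν, hν, hmin⟩ := WellFounded.has_min (wellFounded_lt (α := Ordinal.{u}))
    {ν | HasLadder W ν α} ⟨α, id, hW.ograph_id_mem α, fun _ _ _ _ h => h, fun _ h => h,
      fun β hβ => ⟨β + 1, hαl.add_one_lt hβ, by simp⟩⟩
  have hreg := hW.isRegularIn_of_forall_le hαl hν fun σ hσ => not_lt.1 (hmin σ hσ)
  have hcof : ν.cof = μ := by
    obtain ⟨h, _, hl⟩ := hν
    rw [← hα, hl.cof_eq]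
  have hle : μ.ord ≤ ν := by
    rw [← hcof]
    exact Ordinal.ord_cof_le ν
  rcases hle.eq_or_lt with h | h
  · rwa [h]
  · have := hW.lt_cof_of_stationaryCorrectAt hreg
      (hθ _ hreg (Ordinal.toZFSet_mem_toZFSet_iff.2 (hμθ.trans h))) hμ h
    exact absurd hcof this.ne'

end IsTransitiveModel

/-- The ordinal `o` as an element of the model. -/
noncomputable def IsTransitiveModel.ord {W : Class.{u}} (hW : IsTransitiveModel W)
    (o : Ordinal.{u}) : Elem W :=
  ⟨o.toZFSet, hW.toZFSet o⟩

/-- The map on the ordinals induced by a map between models. -/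
noncomputable def ordMap {M N : Class.{u}} (hM : IsTransitiveModel M) (j : Elem M → Elem N)
    (o : Ordinal.{u}) : Ordinal.{u} :=
  (j (hM.ord o)).val.rank

/-! ### Closure points -/

/-- The nonzero ordinals closed under `s`. -/
def closurePoints (s : Ordinal.{u} → Ordinal.{u}) : Set Ordinal.{u} :=
  {ξ | 0 < ξ ∧ ∀ i < ξ, s i < ξ}

/-- For unboundedness, a bound of `s` on initial segments is iterated `ω` times. Regularity supplies
these bounds, and uncountability keeps the limit below `ρ.ord`. -/
theorem isClubBelow_closurePoints {ρ : Cardinal.{u}} (hρ : ρ.IsRegular) (hρ0 : ρ ≠ Cardinal.aleph0)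
    {s : Ordinal.{u} → Ordinal.{u}} (hs : ∀ i < ρ.ord, s i < ρ.ord) :
    IsClubBelow ρ.ord (closurePoints s) := by
  constructor
  · intro a ha
    have hl : Order.IsSuccLimit ρ.ord :=
      isSuccLimit_of_aleph0_le_cof (hρ.cof_ord.symm ▸ hρ.aleph0_le)
    have hb : ∀ b, ∃ γ, b < ρ.ord → γ < ρ.ord ∧ ∀ i < b, s i ≤ γ := by
      intro b
      by_cases h : b < ρ.ord
      · obtain ⟨γ, h1, h2⟩ := exists_bound_of_card_lt_cof (ν := ρ.ord)
          (by rw [hρ.cof_ord]; exact Cardinal.lt_ord.1 h) fun i hi => hs i (hi.trans h)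
        exact ⟨γ, fun _ => ⟨h1, h2⟩⟩
      · exact ⟨0, fun h' => absurd h' h⟩
    choose γ hγ using hb
    have ht : ∀ b < ρ.ord, γ b + 1 < ρ.ord := fun b hb => hl.add_one_lt (hγ b hb).1
    have hn : Ordinal.nfp (fun b => γ b + 1) (a + 1) < ρ.ord :=
      Cardinal.nfp_lt_ord_of_isRegular hρ hρ0 (fun b hb => ht b hb) (hl.add_one_lt ha)
    have hit : ∀ n, (fun b => γ b + 1)^[n] (a + 1) < ρ.ord := fun n =>
      (Ordinal.iterate_le_nfp _ _ n).trans_lt hn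
    have ha1 : a < Ordinal.nfp (fun b => γ b + 1) (a + 1) :=
      (Order.lt_add_one_iff.2 le_rfl).trans_le (Ordinal.le_nfp _ _)
    refine ⟨_, ⟨pos_of_gt ha1, fun i hi => ?_⟩, hn, ha1⟩
    obtain ⟨n, hn'⟩ := Ordinal.lt_nfp_iff.1 hi
    refine Ordinal.lt_nfp_iff.2 ⟨n + 1, ?_⟩
    rw [Function.iterate_succ_apply']
    exact Order.lt_add_one_iff.2 ((hγ _ (hit n)).2 i hn')
  · intro γ _ h0 hub
    refine ⟨h0, fun i hi => ?_⟩
    obtain ⟨b, hb, hbγ, hib⟩ := hub i hi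
    exact (hb.2 i hib).trans hbγ

theorem exists_closurePoint_gt {s : Ordinal.{u} → Ordinal.{u}} (hs : Monotone s)
    (β : Ordinal.{u}) : ∃ ξ, β < ξ ∧ ∀ i < ξ, s i < ξ := by
  refine ⟨Ordinal.nfp (fun b => s b + 1) (β + 1),
    (Order.lt_add_one_iff.2 le_rfl).trans_le (Ordinal.le_nfp _ _), fun i hi => ?_⟩
  obtain ⟨n, hn⟩ := Ordinal.lt_nfp_iff.1 hi
  refine Ordinal.lt_nfp_iff.2 ⟨n + 1, ?_⟩
  rw [Function.iterate_succ_apply']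
  exact Order.lt_add_one_iff.2 (hs hn.le)

theorem IsLadder.comp {f g : Ordinal.{u} → Ordinal.{u}} {τ ξ α : Ordinal.{u}}
    (hf : IsLadder f ξ α) (hg : IsLadder g τ ξ) : IsLadder (f ∘ g) τ α := by
  refine ⟨fun i hi k hk hik => hf.strictMono (hg.lt i hi) (hg.lt k hk) (hg.strictMono hi hk hik),
    fun i hi => hf.lt _ (hg.lt i hi), fun β hβ => ?_⟩
  obtain ⟨k, hk, hβk⟩ := hf.cofinal β hβ
  obtain ⟨i, hi, hki⟩ := hg.cofinal k hk
  exact ⟨i, hi, hβk.trans (hf.strictMono hk (hg.lt i hi) hki)⟩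

theorem IsTransitiveModel.ograph_comp {W : Class.{u}} (hW : IsTransitiveModel W)
    {f g : Ordinal.{u} → Ordinal.{u}} {τ ξ ν α : Ordinal.{u}} (hf : W (ograph ν f))
    (hg : W (ograph τ g)) (hξ : ξ ≤ ν) (hfl : IsLadder f ξ α) (hgl : IsLadder g τ ξ) :
    W (ograph τ (f ∘ g)) := by
  refine hW.graph_mem ![⟨_, hW.toZFSet τ⟩, ⟨_, hW.toZFSet α⟩, ⟨_, hW.toZFSet ξ⟩, ⟨_, hg⟩, ⟨_, hf⟩]
    0 1 (Q := fun v i y => ∃ b ∈ v 2, ZFSet.pair i b ∈ v 3 ∧ ZFSet.pair b y ∈ v 4)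
    (.bex (.fv _) <| .and (.pair_mem IsVar.top.pop.pop .top (.fv _)) <|
      .pair_mem .top IsVar.top.pop (.fv _)) rfl fun i hi y => ?_
  change (y ∈ α.toZFSet ∧ ∃ b ∈ ξ.toZFSet, ZFSet.pair _ b ∈ ograph τ g ∧
    ZFSet.pair b y ∈ ograph ν f) ↔ _
  simp only [exists_mem_toZFSet, toZFSet_pair_mem_graph, Ordinal.toZFSet_injective.eq_iff]
  constructor
  · rintro ⟨_, b, _, ⟨_, rfl⟩, _, h⟩
    exact h
  · rintro rfl
    exact ⟨Ordinal.toZFSet_mem_toZFSet_iff.2 (hfl.lt _ (hgl.lt i hi)), _, hgl.lt i hi, ⟨hi, rfl⟩,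
      (hgl.lt i hi).trans_le hξ, rfl⟩

/-! ### The action of the embedding on ordinals -/

namespace IsElementary

variable {M N : Class.{u}} {j : Elem M → Elem N}

theorem mem_iff (hM : IsTransitiveModel M) (hN : IsTransitiveModel N) (hj : IsElementary j)
    (x y : Elem M) : (j x).val ∈ (j y).val ↔ x.val ∈ y.val :=
  hj.iff hM hN (R := fun c => c.1 0 ∈ c.1 1) (.mem (.fv _) (.fv _)) ![x, y]

theorem map_ord (hM : IsTransitiveModel M) (hN : IsTransitiveModel N) (hj : IsElementary j)
    (o : Ordinal.{u}) : (j (hM.ord o)).val = (ordMap hM j o).toZFSet := by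
  have : (j (hM.ord o)).val.IsOrdinal :=
    (hj.iff hM hN (R := fun c => (c.1 0).IsOrdinal) (.isOrdinal (.fv _)) ![hM.ord o]).2
      (ZFSet.isOrdinal_toZFSet o)
  exact this.toZFSet_rank_eq.symm

theorem ordMap_strictMono (hM : IsTransitiveModel M) (hN : IsTransitiveModel N)
    (hj : IsElementary j) : StrictMono (ordMap hM j) := by
  intro a b hab
  have := (hj.mem_iff hM hN (hM.ord a) (hM.ord b)).2 (Ordinal.toZFSet_mem_toZFSet_iff.2 hab)
  rwa [hj.map_ord hM hN, hj.map_ord hM hN, Ordinal.toZFSet_mem_toZFSet_iff] at this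

theorem pair_mem_iff (hM : IsTransitiveModel M) (hN : IsTransitiveModel N) (hj : IsElementary j)
    (x y f : Elem M) :
    ZFSet.pair (j x).val (j y).val ∈ (j f).val ↔ ZFSet.pair x.val y.val ∈ f.val :=
  hj.iff hM hN (R := fun c => ZFSet.pair (c.1 0) (c.1 1) ∈ c.1 2)
    (.pair_mem (.fv _) (.fv _) (.fv _)) ![x, y, f]

theorem ord_pair_mem (hM : IsTransitiveModel M) (hN : IsTransitiveModel N) (hj : IsElementary j)
    {a b : Ordinal.{u}} {f : Elem M} (h : ZFSet.pair a.toZFSet b.toZFSet ∈ f.val) :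
    ZFSet.pair (ordMap hM j a).toZFSet (ordMap hM j b).toZFSet ∈ (j f).val := by
  have := (hj.pair_mem_iff hM hN (hM.ord a) (hM.ord b) f).2 h
  rwa [hj.map_ord hM hN, hj.map_ord hM hN] at this

/-- An elementary embedding which fixes all ordinals is trivial. -/
theorem isTrivial_of_ordMap_eq (hM : IsTransitiveModel M) (hN : IsTransitiveModel N)
    (hj : IsElementary j) (h : ∀ o, ordMap hM j o = o) : IsTrivial j := by
  have key : ∀ x : ZFSet.{u}, ∀ hx : M x, (j ⟨x, hx⟩).val = x := by
    intro x
    induction x using ZFSet.inductionOn with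
    | _ x ih =>
      intro hx
      obtain ⟨τ, g, hg, hgX, hsurj⟩ := hM.exists_surjection hx
      -- The image of the enumeration maps `j τ = τ` onto `j x`, and its value at `i = j i` is `j (g
      -- i)`, which is `g i` by induction.
      have hs := (hj.iff hM hN (R := fun c => ∀ y ∈ c.1 0, ∃ i ∈ c.1 1, ZFSet.pair i y ∈ c.1 2)
        (.ball (.fv _) <| .bex (.fv _) <| .pair_mem .top IsVar.top.pop (.fv _))
        ![⟨x, hx⟩, hM.ord τ, ⟨_, hg⟩]).2 (by
          intro y hy
          obtain ⟨i, hi, rfl⟩ := hsurj y hy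
          exact ⟨_, Ordinal.toZFSet_mem_toZFSet_iff.2 hi, toZFSet_pair_mem_graph.2 ⟨hi, rfl⟩⟩)
      have hf := (hj.iff hM hN (R := fun c => ∀ i ∈ c.1 1, ∀ y ∈ c.1 0, ∀ z ∈ c.1 0,
          ZFSet.pair i y ∈ c.1 2 → ZFSet.pair i z ∈ c.1 2 → y = z)
        (.ball (.fv _) <| .ball (.fv _) <| .ball (.fv _) <|
          .imp (.pair_mem IsVar.top.pop.pop IsVar.top.pop (.fv _)) <|
          .imp (.pair_mem IsVar.top.pop.pop IsVar.top (.fv _)) <| .eq IsVar.top.pop .top)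
        ![⟨x, hx⟩, hM.ord τ, ⟨_, hg⟩]).2 (by
          intro i hi y _ z _ h1 h2
          obtain ⟨i, _, rfl⟩ := Ordinal.mem_toZFSet_iff.1 hi
          rw [(toZFSet_pair_mem_graph.1 h1).2, (toZFSet_pair_mem_graph.1 h2).2])
      ext z
      constructor
      · intro hz
        obtain ⟨i, hi, hp⟩ := hs z hz
        change i ∈ (j (hM.ord τ)).val at hi
        have hi' := hi
        rw [hj.map_ord hM hN, h] at hi'
        obtain ⟨i, hiτ, rfl⟩ := Ordinal.mem_toZFSet_iff.1 hi'
        have hWg := hM.mem_trans (hgX i hiτ) hx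
        have hp' := (hj.pair_mem_iff hM hN (hM.ord i) ⟨g i, hWg⟩ ⟨_, hg⟩).2
          (toZFSet_pair_mem_graph.2 ⟨hiτ, rfl⟩)
        rw [hj.map_ord hM hN, h] at hp'
        have hmem := (hj.mem_iff hM hN ⟨g i, hWg⟩ ⟨x, hx⟩).2 (hgX i hiτ)
        rw [hf _ hi _ hz _ hmem hp hp', ih _ (hgX i hiτ)]
        exact hgX i hiτ
      · intro hz
        have hmem := (hj.mem_iff hM hN ⟨z, hM.mem_trans hz hx⟩ ⟨x, hx⟩).2 hz
        rwa [ih z hz] at hmem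
  refine ⟨Class.ext fun x => ⟨fun hx => ?_, fun hx => ?_⟩, fun x => key x.1 x.2⟩
  · rw [← key x hx]
    exact (j ⟨x, hx⟩).2
  · obtain ⟨y, hy⟩ := hj.cofinal ⟨x, hx⟩
    have hy : x ∈ (j y).val := hy
    rw [key y.1 y.2] at hy
    exact hM.mem_trans hy y.2

theorem isLadderSet_map (hM : IsTransitiveModel M) (hN : IsTransitiveModel N) (hj : IsElementary j)
    {f : Elem M} {τ α : Ordinal.{u}} (h : IsLadderSet f.val τ.toZFSet α.toZFSet) :
    IsLadderSet (j f).val (ordMap hM j τ).toZFSet (ordMap hM j α).toZFSet := by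
  have := (hj.iff hM hN (R := fun c => IsLadderSet (c.1 0) (c.1 1) (c.1 2))
    (.isLadderSet (.fv _) (.fv _) (.fv _)) ![f, hM.ord τ, hM.ord α]).2 h
  rwa [← hj.map_ord hM hN, ← hj.map_ord hM hN]

/-- An elementary embedding fixes its closure points which have a ladder of fixed length. -/
theorem ordMap_eq_of_hasLadder (hM : IsTransitiveModel M) (hN : IsTransitiveModel N)
    (hj : IsElementary j) {τ α : Ordinal.{u}} (hτ : ordMap hM j τ = τ)
    (hα : ∀ β < α, ordMap hM j β < α) (h : HasLadder M τ α) : ordMap hM j α = α := by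
  have hmono := hj.ordMap_strictMono hM hN
  refine le_antisymm (le_of_forall_lt fun β hβ => ?_) hmono.le_apply
  obtain ⟨g, hg, hl⟩ := h
  obtain ⟨g', hg', hl'⟩ := isLadderSet_iff.1
    (hj.isLadderSet_map hM hN (f := ⟨_, hg⟩) (isLadderSet_iff.2 ⟨g, rfl, hl⟩))
  rw [hτ] at hg' hl'
  obtain ⟨i, hi, hβi⟩ := hl'.cofinal β hβ
  have hp := hj.ord_pair_mem hM hN (f := ⟨_, hg⟩) (pair_mem_ograph.2 ⟨hi, rfl⟩)
  rw [hg', pair_mem_ograph] at hp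
  -- Here `g' i ≤ g' (j i) = j (g i) < α`: the image ladder, cofinal in `j α`, stays below `α`.
  have hle : g' i ≤ g' (ordMap hM j i) := hl'.strictMono.monotoneOn hi hp.1 hmono.le_apply
  rw [← hp.2] at hle
  exact hβi.trans (hle.trans_lt (hα _ (hl.lt i hi)))

/-- Every nonempty element of `ω` has a greatest element. This `Δ₀` property passes to `j ω`, which
therefore cannot contain `ω`. -/
theorem ordMap_omega0 (hM : IsTransitiveModel M) (hN : IsTransitiveModel N)
    (hj : IsElementary j) : ordMap hM j Ordinal.omega0 = Ordinal.omega0 := by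
  have hmono := hj.ordMap_strictMono hM hN
  refine le_antisymm ?_ hmono.le_apply
  by_contra! hlt
  have := (hj.iff hM hN (R := fun c => ∀ n ∈ c.1 0, n.Nonempty → ∃ m ∈ n, ∀ k ∈ n, k ⊆ m)
    (.ball (.fv _) <| .imp (.nonempty .top) <| .bex .top <| .ball IsVar.top.pop <|
      .subset .top IsVar.top.pop) ![hM.ord Ordinal.omega0]).2 (by
      intro n hn hne
      obtain ⟨n, hnω, rfl⟩ := Ordinal.mem_toZFSet_iff.1 hn
      obtain ⟨n, rfl⟩ := Ordinal.lt_omega0.1 hnω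
      cases n with
      | zero =>
        obtain ⟨z, hz⟩ := hne
        simp at hz
      | succ n =>
        refine ⟨(n : Ordinal.{u}).toZFSet, Ordinal.toZFSet_mem_toZFSet_iff.2 (by simp), ?_⟩
        rw [forall_mem_toZFSet]
        intro a ha
        rw [Ordinal.toZFSet_subset_toZFSet_iff]
        rw [Nat.cast_succ] at ha
        exact Order.lt_add_one_iff.1 ha)
  change ∀ n ∈ (j (hM.ord Ordinal.omega0)).val, _ at this
  rw [hj.map_ord hM hN] at this
  obtain ⟨m, hm, hmax⟩ := this _ (Ordinal.toZFSet_mem_toZFSet_iff.2 hlt)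
    ⟨_, Ordinal.toZFSet_mem_toZFSet_iff.2 Ordinal.omega0_pos⟩
  obtain ⟨m, hmω, rfl⟩ := Ordinal.mem_toZFSet_iff.1 hm
  have := hmax _ (Ordinal.toZFSet_mem_toZFSet_iff.2 (Ordinal.isSuccLimit_omega0.add_one_lt hmω))
  rw [Ordinal.toZFSet_subset_toZFSet_iff] at this
  exact this.not_gt (by simp)

end IsElementary

/-! ### Fixed limit cardinals and the gap above them -/

/-- The ordinal `l` is closed under cardinal successors. -/
def IsLimitCard (l : Ordinal.{u}) : Prop := ∀ a < l, (Order.succ a.card).ord < l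

namespace IsElementary

variable {M N : Class.{u}} {j : Elem M → Elem N}

/-- There are arbitrarily large fixed points which are limit cardinals of cofinality `ω`. -/
theorem exists_fixed_limitCard (hM : IsTransitiveModel M) (hN : IsTransitiveModel N)
    (hj : IsElementary j) {θ : Ordinal.{u}}
    (hθ : ∀ δ, IsRegularIn M δ → θ.toZFSet ∈ δ → StationaryCorrectAt M δ) (β : Ordinal.{u}) :
    ∃ l, β < l ∧ ordMap hM j l = l ∧ IsLimitCard l ∧ l.cof = Cardinal.aleph0 := by
  have hmono := hj.ordMap_strictMono hM hN
  let H : Ordinal.{u} → Ordinal.{u} := fun a => max (ordMap hM j a) (Order.succ a.card).ord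
  have hH : Monotone H := fun a b hab => max_le_max (hmono.monotone hab)
    (Cardinal.ord_le_ord.2 (Order.succ_le_succ (Ordinal.card_le_card hab)))
  let C : Set Ordinal.{u} := {l | β < l ∧ ∀ a < l, H a < l}
  have hC : ¬ BddAbove C := by
    rintro ⟨b, hb⟩
    obtain ⟨l, hl, hcl⟩ := exists_closurePoint_gt hH (max b β)
    exact (hb ⟨(le_max_right _ _).trans_lt hl, hcl⟩).not_gt ((le_max_left _ _).trans_lt hl)
  have hcm := Ordinal.enumOrd_strictMono hC
  have hcC := fun i => Ordinal.enumOrd_mem hC i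
  set c := Ordinal.enumOrd C
  obtain ⟨ρ, hρ, hρ0, hρθ⟩ : ∃ ρ : Cardinal.{u}, ρ.IsRegular ∧ Cardinal.aleph0 < ρ ∧ θ < ρ.ord := by
    refine ⟨Order.succ (max Cardinal.aleph0 θ.card), Cardinal.isRegular_succ (le_max_left _ _),
      (le_max_left _ _).trans_lt (Order.lt_succ _), Cardinal.lt_ord.2 ?_⟩
    exact (le_max_right _ _).trans_lt (Order.lt_succ _)
  have hρl : Order.IsSuccLimit ρ.ord :=
    isSuccLimit_of_aleph0_le_cof (hρ.cof_ord.symm ▸ hρ.aleph0_le)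
  obtain ⟨L, hL, hLmin⟩ := WellFounded.has_min (wellFounded_lt (α := Ordinal.{u}))
    {L | ∀ i < ρ.ord, c i < L} ⟨c ρ.ord, fun i hi => hcm hi⟩
  have hcL : IsLadder c ρ.ord L := by
    refine ⟨hcm.strictMonoOn _, hL, fun b hb => ?_⟩
    have : ¬ ∀ i < ρ.ord, c i < b := fun h => hLmin b h hb
    push Not at this
    obtain ⟨i, hi, hle⟩ := this
    exact ⟨i + 1, hρl.add_one_lt hi, hle.trans_lt (hcm (by simp))⟩
  -- A limit of `ω` points of `C` need not have cofinality `ω` in `M`. So `M` first gets a ladder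
  -- `f` to a point `L` of large cofinality `ρ`; correctness at `ρ` then gives an initial segment of
  -- `f` whose length `ξ` has a ladder of length `ω` in `M`.
  obtain ⟨f, hf, hfL⟩ := hM.hasLadder_of_cof_eq hθ hρ hρθ (hcL.cof_eq.trans hρ.cof_ord)
  -- A point of `C` lies between `f i` and `f (s i)`, so at a closure point of `s` the values of `f`
  -- converge to a limit of points of `C`.
  have hs : ∀ i, ∃ k, i < ρ.ord → k < ρ.ord ∧ ∃ l ∈ C, f i < l ∧ l < f k := by
    intro i
    by_cases hi : i < ρ.ord
    · obtain ⟨m, hm, h1⟩ := hcL.cofinal _ (hfL.lt i hi)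
      obtain ⟨k, hk, h2⟩ := hfL.cofinal _ (hcL.lt m hm)
      exact ⟨k, fun _ => ⟨hk, c m, hcC m, h1, h2⟩⟩
    · exact ⟨0, fun h => absurd h hi⟩
  choose s hs using hs
  obtain ⟨ξ, hξ, ⟨hξ0, hξs⟩, g, hg, hgξ⟩ := hM.exists_hasLadder_mem_club (hM.isRegularIn_ord hρ)
    (hθ _ (hM.isRegularIn_ord hρ) (Ordinal.toZFSet_mem_toZFSet_iff.2 hρθ))
    (Cardinal.lt_ord.2 (by rwa [Ordinal.card_omega0])) Ordinal.isSuccLimit_omega0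
    (isClubBelow_closurePoints hρ hρ0.ne' fun i hi => (hs i hi).1)
  obtain ⟨l, hl, hlmin⟩ := WellFounded.has_min (wellFounded_lt (α := Ordinal.{u}))
    {l | ∀ i < ξ, f i < l} ⟨f ξ, fun i hi => hfL.strictMono (hi.trans hξ) hξ hi⟩
  have hcof : ∀ b < l, ∃ m ∈ C, b < m ∧ ∃ k < ξ, m < f k := by
    intro b hb
    have : ¬ ∀ i < ξ, f i < b := fun h => hlmin b h hb
    push Not at this
    obtain ⟨i, hi, hle⟩ := this
    obtain ⟨_, m, hm, h1, h2⟩ := hs i (hi.trans hξ)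
    exact ⟨m, hm, hle.trans_lt h1, s i, hξs i hi, h2⟩
  have hfl : IsLadder f ξ l := by
    refine ⟨hfL.strictMono.mono (Set.Iio_subset_Iio hξ.le), hl, fun b hb => ?_⟩
    obtain ⟨m, _, hbm, k, hk, hmk⟩ := hcof b hb
    exact ⟨k, hk, hbm.trans hmk⟩
  have hlC : l ∈ C := by
    refine ⟨?_, fun a ha => ?_⟩
    · obtain ⟨m, hm, _, k, hk, hmk⟩ := hcof 0 (pos_of_gt (hl 0 hξ0))
      exact hm.1.trans (hmk.trans (hl k hk))
    · obtain ⟨m, hm, ham, k, hk, hmk⟩ := hcof a ha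
      exact (hm.2 a ham).trans (hmk.trans (hl k hk))
  have hlad := hfl.comp hgξ
  refine ⟨l, hlC.1, hj.ordMap_eq_of_hasLadder hM hN (hj.ordMap_omega0 hM hN)
    (fun a ha => (le_max_left _ _).trans_lt (hlC.2 a ha))
    ⟨_, hM.ograph_comp hf hg hξ.le hfl hgξ, hlad⟩,
    fun a ha => (le_max_right _ _).trans_lt (hlC.2 a ha), ?_⟩
  rw [hlad.cof_eq, Ordinal.cof_omega0]

end IsElementary

/-- A stationary correct model has no regular cardinals between a singular limit cardinal and its
successor. -/
theorem IsTransitiveModel.not_isRegularIn {M : Class.{u}} (hM : IsTransitiveModel M)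
    {θ : Ordinal.{u}} (hθ : ∀ δ, IsRegularIn M δ → θ.toZFSet ∈ δ → StationaryCorrectAt M δ)
    {l x : Ordinal.{u}} (hl : IsLimitCard l) (hlω : Ordinal.omega0 < l)
    (hcof : l.cof = Cardinal.aleph0) (hθl : θ < l) (hlx : l < x)
    (hx : x < (Order.succ l.card).ord) : ¬ IsRegularIn M x.toZFSet := by
  intro hreg
  have hlc : l.card.ord = l := by
    refine le_antisymm (Cardinal.ord_card_le l) ?_
    by_contra! h
    have := hl _ h
    rw [Cardinal.card_ord] at this
    exact this.not_gt (Cardinal.lt_ord.2 (Order.lt_succ _))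
  have hxl : Order.IsSuccLimit x := by
    obtain ⟨h0, h1, _⟩ := hM.isRegularIn_iff.1 hreg
    refine Ordinal.isSuccLimit_iff.2 ⟨h0.ne', Order.isSuccPrelimit_of_succ_lt fun a ha => ?_⟩
    obtain ⟨b, hb, hab⟩ := h1 a ha
    exact (Order.succ_le_of_lt hab).trans_lt hb
  have hxc : x.cof.IsRegular := Cardinal.isRegular_cof hxl
  have hle : x.cof ≤ l.card :=
    (Ordinal.cof_le_card x).trans (Order.lt_succ_iff.1 (Cardinal.lt_ord.1 hx))
  -- `x.cof` is regular, whereas `l` is uncountable of cofinality `ω`.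
  have hne : x.cof ≠ l.card := by
    intro h
    have h1 := hxc.cof_ord
    rw [h, hlc, hcof] at h1
    rw [← h1, Cardinal.ord_aleph0] at hlc
    exact hlω.ne hlc
  have hlt : x.cof.ord < l := by
    rw [← hlc]
    exact Cardinal.ord_lt_ord.2 (hle.lt_of_ne hne)
  have hκ := hl _ hlt
  rw [Cardinal.card_ord] at hκ
  -- The successor cardinal of `x.cof` is still below `l`, and correctness at `x` would put it below
  -- `x.cof`.
  have := hM.lt_cof_of_stationaryCorrectAt hreg
    (hθ _ hreg (Ordinal.toZFSet_mem_toZFSet_iff.2 (hθl.trans hlx)))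
    (Cardinal.isRegular_succ hxc.aleph0_le) (hκ.trans hlx)
  exact this.not_ge (Order.le_succ _)

/-! ### Ladder systems and stationary values -/

/-- If ladders are attached to the points of a stationary set, then some coordinate of the ladders
takes unboundedly many values stationarily often. -/
theorem exists_coordinate {μ κ : Cardinal.{u}} (hκ : κ.IsRegular) (hκ0 : κ ≠ Cardinal.aleph0)
    (hμκ : μ < κ) {S : Set Ordinal.{u}}
    (hS : ∀ D, IsClubBelow κ.ord D → ∃ α < κ.ord, α ∈ D ∧ α ∈ S)
    {F : Ordinal.{u} → Ordinal.{u} → Ordinal.{u}} (hF : ∀ α ∈ S, IsLadder (F α) μ.ord α) :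
    ∃ ξ < μ.ord, ∀ η < κ.ord, ∃ γ < κ.ord, η < γ ∧
      ∀ D, IsClubBelow κ.ord D → ∃ α < κ.ord, α ∈ D ∧ α ∈ S ∧ F α ξ = γ := by
  -- Otherwise, for every `ξ` and every large `γ`, some club avoids the points whose ladder has
  -- value `γ` at `ξ`. The diagonal intersection of these clubs meets `S` in some `α`, whose ladder
  -- takes a value `γ` above the common bound at some `ξ`; but `α` lies in the club that excludes
  -- this.
  by_contra! hcon
  have hl : Order.IsSuccLimit κ.ord :=
    isSuccLimit_of_aleph0_le_cof (hκ.cof_ord.symm ▸ hκ.aleph0_le)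
  have hμb : ∀ f : Ordinal.{u} → Ordinal.{u}, (∀ i < μ.ord, f i < κ.ord) →
      ∃ γ < κ.ord, ∀ i < μ.ord, f i ≤ γ := fun f hf =>
    exists_bound_of_card_lt_cof (by rwa [hκ.cof_ord, Cardinal.card_ord]) hf
  choose! η hη hD using hcon
  obtain ⟨η₀, hη₀, hηb⟩ := hμb η hη
  choose! D hDc hDS using hD
  -- `n ξ γ b` is an element of `D ξ γ` above `b`; then `e γ b` bounds it over all `ξ`, and `s b`
  -- bounds that over `γ ≤ b`. The default `0` is never used.
  have hnext : ∀ ξ γ b, ∃ d, ξ < μ.ord → γ < κ.ord → η ξ < γ → b < κ.ord →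
      d ∈ D ξ γ ∧ d < κ.ord ∧ b < d := by
    intro ξ γ b
    by_cases h : ξ < μ.ord ∧ γ < κ.ord ∧ η ξ < γ ∧ b < κ.ord
    · obtain ⟨h1, h2, h3, h4⟩ := h
      obtain ⟨d, hd⟩ := (hDc ξ h1 γ h2 h3).1 b h4
      exact ⟨d, fun _ _ _ _ => hd⟩
    · exact ⟨0, fun h1 h2 h3 h4 => absurd ⟨h1, h2, h3, h4⟩ h⟩
  choose n hn using hnext
  have hb1 : ∀ γ b, ∃ e, γ < κ.ord → η₀ < γ → b < κ.ord →
      e < κ.ord ∧ ∀ ξ < μ.ord, n ξ γ b ≤ e := by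
    intro γ b
    by_cases h : γ < κ.ord ∧ η₀ < γ ∧ b < κ.ord
    · obtain ⟨h2, h3, h4⟩ := h
      obtain ⟨e, he⟩ := hμb (fun ξ => n ξ γ b) fun ξ hξ =>
        (hn ξ γ b hξ h2 ((hηb ξ hξ).trans_lt h3) h4).2.1
      exact ⟨e, fun _ _ _ => he⟩
    · exact ⟨0, fun h2 h3 h4 => absurd ⟨h2, h3, h4⟩ h⟩
  choose e he using hb1
  have hb2 : ∀ b, ∃ s, b < κ.ord → s < κ.ord ∧ ∀ γ ≤ b, η₀ < γ → e γ b ≤ s := by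
    intro b
    by_cases hb : b < κ.ord
    · obtain ⟨s, hs, hs'⟩ := exists_bound_of_card_lt_cof (a := b + 1) (ν := κ.ord)
        (f := fun γ => if η₀ < γ then e γ b else 0)
        (by rw [hκ.cof_ord]; exact Cardinal.lt_ord.1 (hl.add_one_lt hb))
        (fun γ hγ => by
          split_ifs with h
          · exact (he γ b ((Order.lt_add_one_iff.1 hγ).trans_lt hb) h hb).1
          · exact hl.bot_lt)
      refine ⟨s, fun _ => ⟨hs, fun γ hγ hlt => ?_⟩⟩
      have := hs' γ (Order.lt_add_one_iff.2 hγ)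
      rwa [if_pos hlt] at this
    · exact ⟨0, fun h => absurd h hb⟩
  choose s hs using hb2
  obtain ⟨α, hα, ⟨hα0, hαs⟩, hαS⟩ := hS _ (isClubBelow_closurePoints hκ hκ0
    (s := fun b => max η₀ (s b)) fun b hb => max_lt hη₀ (hs b hb).1)
  have hηα : η₀ < α := (le_max_left _ _).trans_lt (hαs 0 hα0)
  obtain ⟨ξ, hξ, hγ⟩ := (hF α hαS).cofinal _ hηα
  have hγα := (hF α hαS).lt ξ hξ
  set γ := F α ξ with hγdef
  have hγκ := hγα.trans hα
  have hηγ := (hηb ξ hξ).trans_lt hγ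
  refine hDS ξ hξ γ hγκ hηγ α hα ((hDc ξ hξ γ hγκ hηγ).2 α hα hα0 fun a ha => ?_) hαS rfl
  have hb : max a γ < α := max_lt ha hγα
  have hbκ := hb.trans hα
  obtain ⟨h1, _, h3⟩ := hn ξ γ (max a γ) hξ hγκ hηγ hbκ
  refine ⟨_, h1, ?_, (le_max_left _ _).trans_lt h3⟩
  exact (((he γ _ hγκ hγ hbκ).2 ξ hξ).trans ((hs _ hbκ).2 γ (le_max_right _ _) hγ)).trans_lt
    ((le_max_right _ _).trans_lt (hαs _ hb))

theorem D0.isClubIn {α : Type} {n : ℕ} {p q : Ctx.{u} α n → ZFSet.{u}} (hp : IsVar p)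
    (hq : IsVar q) : D0 fun c => IsClubIn (p c) (q c) :=
  .and (.subset hq hp) <| .and (.ball hp <| .bex hq.pop <| .mem IsVar.top.pop .top) <|
    .ball hp <| .imp (.nonempty .top) <| .imp
      (.ball .top <| .bex hq.pop.pop <| .and (.mem .top IsVar.top.pop.pop)
        (.mem IsVar.top.pop .top)) (.mem .top hq.pop)

theorem IsLadder.unique {h : Ordinal.{u} → Ordinal.{u}} {τ α β : Ordinal.{u}}
    (hα : IsLadder h τ α) (hβ : IsLadder h τ β) : α = β := by
  by_contra hne
  rcases lt_or_gt_of_ne hne with h | h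
  · obtain ⟨i, hi, h'⟩ := hβ.cofinal α h
    exact h'.not_gt (hα.lt i hi)
  · obtain ⟨i, hi, h'⟩ := hα.cofinal β h
    exact h'.not_gt (hβ.lt i hi)

theorem IsLadder.congr {g h : Ordinal.{u} → Ordinal.{u}} {τ α : Ordinal.{u}}
    (hg : IsLadder g τ α) (hgh : ograph τ g = ograph τ h) : IsLadder h τ α := by
  have : ∀ i < τ, g i = h i := fun i hi => by
    have := (pair_mem_ograph (τ := τ) (h := g)).2 ⟨hi, rfl⟩
    rw [hgh, pair_mem_ograph] at this
    exact this.2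
  refine ⟨fun i hi k hk hik => ?_, fun i hi => ?_, fun β hβ => ?_⟩
  · rw [← this i hi, ← this k hk]
    exact hg.strictMono hi hk hik
  · rw [← this i hi]
    exact hg.lt i hi
  · obtain ⟨i, hi, h'⟩ := hg.cofinal β hβ
    exact ⟨i, hi, by rwa [← this i hi]⟩

/-- A model of choice contains a choice of ladders. -/
theorem IsTransitiveModel.exists_ladder_system {M : Class.{u}} (hM : IsTransitiveModel M)
    {τ δ : Ordinal.{u}} (hτ : τ ≤ δ) :
    ∃ c, M c ∧ (∀ α < δ, HasLadder M τ α → ∃ h, ograph τ h ∈ c ∧ IsLadder h τ α) ∧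
      ∀ f ∈ c, ∀ g ∈ c, ∀ α ∈ δ.toZFSet,
        IsLadderSet f τ.toZFSet α → IsLadderSet g τ.toZFSet α → f = g := by
  have hδ := hM.toZFSet δ
  have hB := hM.pw (hM.pw (hM.pw hδ))
  set B := InnerModel.pw M (InnerModel.pw M (InnerModel.pw M δ.toZFSet)) with hBdef
  have hmB : ∀ f, M f → ∀ α < δ, IsLadderSet f τ.toZFSet α.toZFSet → f ∈ B := by
    intro f hf α hα h
    obtain ⟨g, rfl, hg⟩ := isLadderSet_iff.1 h
    exact hM.graph_mem_pw hδ (Ordinal.toZFSet_subset_toZFSet_iff.2 hτ)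
      (fun i hi => Ordinal.toZFSet_mem_toZFSet_iff.2 ((hg.lt i hi).trans hα)) hf
  -- Each element of `A` is the set of all ladders in `B` for one `α`. These sets are disjoint
  -- because a ladder determines its supremum.
  obtain ⟨A, hA, hmA⟩ : ∃ A, M A ∧ ∀ y, y ∈ A ↔ (M y ∧ y ⊆ B) ∧ y.Nonempty ∧
      ∃ α < δ, ∀ f ∈ B, f ∈ y ↔ IsLadderSet f τ.toZFSet α.toZFSet := by
    refine ⟨_, hM.sep ![⟨_, hδ⟩, ⟨_, hB⟩, hM.ord τ]
      (R := fun c => c.top.Nonempty ∧ ∃ a ∈ c.1 0, ∀ f ∈ c.1 1, f ∈ c.top ↔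
        IsLadderSet f (c.1 2) a)
      (.and (.nonempty .top) <| .bex (.fv _) <| .ball (.fv _) <|
        .iff (.mem .top IsVar.top.pop.pop) <| .isLadderSet .top (.fv _) IsVar.top.pop)
      (hM.pw hB), fun y => ?_⟩
    rw [ZFSet.mem_sep, mem_pw]
    refine and_congr_right fun _ => and_congr_right fun _ => ?_
    exact exists_mem_toZFSet
  obtain ⟨c, hc, hc1⟩ := hM.choice hA (fun y hy => ((hmA y).1 hy).2.1) (by
    intro y hy y' hy' f hf hf'
    obtain ⟨⟨_, hyB⟩, _, α, hα, h⟩ := (hmA y).1 hy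
    obtain ⟨⟨_, hyB'⟩, _, α', hα', h'⟩ := (hmA y').1 hy'
    obtain ⟨g, rfl, hg⟩ := isLadderSet_iff.1 ((h f (hyB hf)).1 hf)
    obtain ⟨g', hgg, hg'⟩ := isLadderSet_iff.1 ((h' _ (hyB hf)).1 hf')
    obtain rfl := (hg.congr hgg).unique hg'
    ext f
    exact ⟨fun hf => (h' f (hyB hf)).2 ((h f (hyB hf)).1 hf),
      fun hf => (h f (hyB' hf)).2 ((h' f (hyB' hf)).1 hf)⟩)
  have hY : ∀ α < δ, HasLadder M τ α → ∃ y ∈ A, ∀ f, f ∈ y ↔ f ∈ B ∧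
      IsLadderSet f τ.toZFSet α.toZFSet := by
    rintro α hα ⟨h, hh, hl⟩
    have hy := hM.sep ![hM.ord τ, hM.ord α] (R := fun c => IsLadderSet c.top (c.1 0) (c.1 1))
      (.isLadderSet .top (.fv _) (.fv _)) hB
    have hmy : ∀ f, f ∈ ZFSet.sep (fun f => IsLadderSet f τ.toZFSet α.toZFSet) B ↔ f ∈ B ∧
      IsLadderSet f τ.toZFSet α.toZFSet := fun f => ZFSet.mem_sep
    refine ⟨_, (hmA _).2 ⟨⟨hy, ZFSet.sep_subset⟩, ⟨ograph τ h, ?_⟩, α, hα, fun f hf => ?_⟩, hmy⟩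
    · have := isLadderSet_iff.2 ⟨h, rfl, hl⟩
      exact (hmy _).2 ⟨hmB _ hh α hα this, this⟩
    · exact (hmy f).trans (and_iff_right hf)
  refine ⟨c, hc, fun α hα hl => ?_, ?_⟩
  · obtain ⟨y, hyA, hy⟩ := hY α hα hl
    obtain ⟨f, ⟨hfy, hfc⟩, _⟩ := hc1 y hyA
    obtain ⟨h, rfl, hl⟩ := isLadderSet_iff.1 ((hy f).1 hfy).2
    exact ⟨h, hfc, hl⟩
  · intro f hf g hg
    rw [forall_mem_toZFSet]
    intro α hα h1 h2
    have hfM := hM.mem_trans hf hc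
    have hgM := hM.mem_trans hg hc
    obtain ⟨h, rfl, hl⟩ := isLadderSet_iff.1 h1
    obtain ⟨y, hyA, hy⟩ := hY α hα ⟨h, hfM, hl⟩
    exact (hc1 y hyA).unique ⟨(hy _).2 ⟨hmB _ hfM α hα h1, h1⟩, hf⟩
      ⟨(hy _).2 ⟨hmB _ hgM α hα h2, h2⟩, hg⟩

namespace IsElementary

variable {M N : Class.{u}} {j : Elem M → Elem N}

/-- By cofinality `C` lies in some `j z`. That the subsets of `x` in `z` belong to the power set is
`Δ₀`, unlike being the power set, and so it transfers. -/
theorem mem_map_pw (hM : IsTransitiveModel M) (hN : IsTransitiveModel N) (hj : IsElementary j)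
    (x : Elem M) {C : ZFSet.{u}} (hC : N C) (hCx : C ⊆ (j x).val) :
    C ∈ (j ⟨_, hM.pw x.2⟩).val := by
  obtain ⟨z, hz⟩ := hj.cofinal ⟨C, hC⟩
  exact (hj.iff hM hN (R := fun c => ∀ y ∈ c.1 0, y ⊆ c.1 1 → y ∈ c.1 2)
    (.ball (.fv _) <| .imp (.subset .top (.fv _)) (.mem .top (.fv _)))
    ![z, x, ⟨_, hM.pw x.2⟩]).2
    (fun y hy hyx => mem_pw.2 ⟨hM.mem_trans hy z.2, hyx⟩) C hz hCx

/-- In `M` every limit ordinal strictly between `l` and `δ = l⁺` is singular. If `δ < j δ`, then `δ`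
lies strictly between `j l = l` and `j δ`, so it is singular in `N` by elementarity; yet `δ` is
regular even in `V`. -/
theorem ordMap_succ_eq (hM : IsTransitiveModel M) (hN : IsTransitiveModel N)
    (hj : IsElementary j) {θ : Ordinal.{u}}
    (hθ : ∀ δ, IsRegularIn M δ → θ.toZFSet ∈ δ → StationaryCorrectAt M δ) {l : Ordinal.{u}}
    (hl : IsLimitCard l) (hlω : Ordinal.omega0 < l) (hcof : l.cof = Cardinal.aleph0) (hθl : θ < l)
    (hjl : ordMap hM j l = l) :
    ordMap hM j (Order.succ l.card).ord = (Order.succ l.card).ord := by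
  have hreg : (Order.succ l.card).IsRegular := Cardinal.isRegular_succ <| by
    rw [← Ordinal.card_omega0]
    exact Ordinal.card_le_card hlω.le
  have hlδ : l < (Order.succ l.card).ord := Cardinal.lt_ord.2 (Order.lt_succ _)
  set δ := (Order.succ l.card).ord with hδdef
  have hmono := hj.ordMap_strictMono hM hN
  refine le_antisymm ?_ hmono.le_apply
  by_contra! hlt
  have hδM := hM.toZFSet δ
  have hB := hM.pw (hM.pw (hM.pw hδM))
  -- The singularizing functions are bounded by the triple power set of `δ`, which makes the
  -- statement `Δ₀`.
  have key := (hj.iff hM hN (R := fun c => ∀ x ∈ c.1 0, c.1 1 ∈ x → (∀ a ∈ x, ∃ b ∈ x, a ∈ b) →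
      ∃ a ∈ x, ∃ f ∈ c.1 2, (∀ e ∈ f, ∃ i ∈ a, ∃ b ∈ x, e = ZFSet.pair i b) ∧
        (∀ i ∈ a, ∃ b ∈ x, ZFSet.pair i b ∈ f) ∧
        (∀ i ∈ a, ∀ b ∈ x, ∀ d ∈ x, ZFSet.pair i b ∈ f → ZFSet.pair i d ∈ f → b = d) ∧
        ∀ g ∈ x, ∃ i ∈ a, ∃ b ∈ x, ZFSet.pair i b ∈ f ∧ g ⊆ b)
    (.ball (.fv _) <| .imp (.mem (.fv _) .top) <|
      .imp (.ball .top <| .bex IsVar.top.pop <| .mem IsVar.top.pop .top) <|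
      .bex .top <| .bex (.fv _) <| .and (.ball .top <| .bex IsVar.top.pop.pop <|
        .bex IsVar.top.pop.pop.pop.pop <| .eq_pair IsVar.top.pop.pop IsVar.top.pop .top) <|
      .and (.ball IsVar.top.pop <| .bex IsVar.top.pop.pop.pop <|
        .pair_mem IsVar.top.pop .top IsVar.top.pop.pop) <|
      .and (.ball IsVar.top.pop <| .ball IsVar.top.pop.pop.pop <| .ball IsVar.top.pop.pop.pop.pop <|
        .imp (.pair_mem IsVar.top.pop.pop IsVar.top.pop IsVar.top.pop.pop.pop) <|
        .imp (.pair_mem IsVar.top.pop.pop .top IsVar.top.pop.pop.pop) <| .eq IsVar.top.pop .top) <|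
      .ball IsVar.top.pop.pop <| .bex IsVar.top.pop.pop <| .bex IsVar.top.pop.pop.pop.pop <|
        .and (.pair_mem IsVar.top.pop .top IsVar.top.pop.pop.pop) <| .subset IsVar.top.pop.pop .top)
    ![hM.ord δ, hM.ord l, ⟨_, hB⟩]).2 (by
      change ∀ x ∈ δ.toZFSet, l.toZFSet ∈ x → _
      rw [forall_mem_toZFSet]
      intro x hx hlx hlim
      rw [Ordinal.toZFSet_mem_toZFSet_iff] at hlx
      simp only [forall_mem_toZFSet, exists_mem_toZFSet, Ordinal.toZFSet_mem_toZFSet_iff] at hlim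
      have hnot := hM.not_isRegularIn hθ hl hlω hcof hθl hlx hx
      rw [hM.isRegularIn_iff, not_and, not_and] at hnot
      have := hnot (pos_of_gt hlx) hlim
      push Not at this
      obtain ⟨a, ha, h, hh, hhx, hub⟩ := this
      refine ⟨a.toZFSet, Ordinal.toZFSet_mem_toZFSet_iff.2 ha, ograph a h, ?_, ?_, ?_, ?_, ?_⟩
      · exact hM.graph_mem_pw hδM (Ordinal.toZFSet_subset_toZFSet_iff.2 (ha.trans hx).le)
          (fun i hi => Ordinal.toZFSet_mem_toZFSet_iff.2 ((hhx i hi).trans hx)) hh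
      · intro e he
        obtain ⟨i, hi, rfl⟩ := mem_graph.1 he
        exact ⟨_, Ordinal.toZFSet_mem_toZFSet_iff.2 hi, _,
          Ordinal.toZFSet_mem_toZFSet_iff.2 (hhx i hi), rfl⟩
      · rw [forall_mem_toZFSet]
        intro i hi
        exact ⟨_, Ordinal.toZFSet_mem_toZFSet_iff.2 (hhx i hi), pair_mem_ograph.2 ⟨hi, rfl⟩⟩
      · rw [forall_mem_toZFSet]
        intro i hi b _ d _ h1 h2
        rw [(toZFSet_pair_mem_graph.1 h1).2, (toZFSet_pair_mem_graph.1 h2).2]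
      · rw [forall_mem_toZFSet]
        intro g hg
        obtain ⟨i, hi, hgi⟩ := hub g hg
        exact ⟨_, Ordinal.toZFSet_mem_toZFSet_iff.2 hi, _,
          Ordinal.toZFSet_mem_toZFSet_iff.2 (hhx i hi), pair_mem_ograph.2 ⟨hi, rfl⟩,
          Ordinal.toZFSet_subset_toZFSet_iff.2 hgi⟩)
  obtain ⟨_, hlim, hbd⟩ := hN.isRegularIn_iff.1 (hN.isRegularIn_ord hreg)
  obtain ⟨a, ha, f, hf, h1, h2, h3, h4⟩ := key δ.toZFSet (by
      change _ ∈ (j (hM.ord δ)).val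
      rw [hj.map_ord hM hN]
      exact Ordinal.toZFSet_mem_toZFSet_iff.2 hlt) (by
      change (j (hM.ord l)).val ∈ _
      rw [hj.map_ord hM hN, hjl]
      exact Ordinal.toZFSet_mem_toZFSet_iff.2 hlδ) (by
      simpa only [forall_mem_toZFSet, exists_mem_toZFSet, Ordinal.toZFSet_mem_toZFSet_iff]
        using hlim)
  obtain ⟨a, haδ, rfl⟩ := Ordinal.mem_toZFSet_iff.1 ha
  simp only [forall_mem_toZFSet, exists_mem_toZFSet, Ordinal.toZFSet_injective.eq_iff,
    Ordinal.toZFSet_subset_toZFSet_iff] at h1 h2 h3 h4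
  obtain ⟨h, rfl, hh⟩ := eq_ograph h1 h2 h3
  obtain ⟨γ, hγ, hb⟩ := hbd a haδ h (hN.mem_trans hf (j _).2) hh
  obtain ⟨i, hi, b, _, hp, hle⟩ := h4 γ hγ
  obtain ⟨_, rfl⟩ := pair_mem_ograph.1 hp
  exact hle.not_gt (hb i hi)

end IsElementary

/-- In a stationary correct model there is a ladder system one of whose coordinates takes
unboundedly many values on stationary sets. -/
theorem IsTransitiveModel.exists_ladder_system_coordinate {M : Class.{u}} (hM : IsTransitiveModel M)
    {θ : Ordinal.{u}} (hθ : ∀ δ, IsRegularIn M δ → θ.toZFSet ∈ δ → StationaryCorrectAt M δ)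
    {μ ρ : Cardinal.{u}} (hμ : μ.IsRegular) (hρ : ρ.IsRegular) (hμρ : μ < ρ) (hθρ : θ < ρ.ord) :
    ∃ c G, M c ∧ M G ∧ G ⊆ ρ.ord.toZFSet ∧ (∀ η < ρ.ord, ∃ γ, η < γ ∧ γ.toZFSet ∈ G) ∧
      (∀ f ∈ c, ∀ g ∈ c, ∀ α ∈ ρ.ord.toZFSet,
        IsLadderSet f μ.ord.toZFSet α → IsLadderSet g μ.ord.toZFSet α → f = g) ∧
      (∀ α < ρ.ord, HasLadder M μ.ord α → ∃ h, ograph μ.ord h ∈ c ∧ IsLadder h μ.ord α) ∧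
      ∃ ξ < μ.ord, ∀ γ ∈ G, ∀ C ∈ InnerModel.pw M ρ.ord.toZFSet, IsClubIn ρ.ord.toZFSet C →
        ∃ α ∈ C, ∃ f ∈ c, IsLadderSet f μ.ord.toZFSet α ∧ ZFSet.pair ξ.toZFSet γ ∈ f := by
  have hμρ' : μ.ord < ρ.ord := Cardinal.ord_lt_ord.2 hμρ
  obtain ⟨c, hc, hsys, huniq⟩ := hM.exists_ladder_system hμρ'.le
  have hreg := hM.isRegularIn_ord hρ
  have hcor := hθ _ hreg (Ordinal.toZFSet_mem_toZFSet_iff.2 hθρ)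
  have hlim : Order.IsSuccLimit μ.ord :=
    isSuccLimit_of_aleph0_le_cof (hμ.cof_ord.symm ▸ hμ.aleph0_le)
  choose! F hFc hF using hsys
  obtain ⟨ξ, hξ, hG⟩ := exists_coordinate (S := {α | α < ρ.ord ∧ HasLadder M μ.ord α}) (F := F)
    hρ (hμ.aleph0_le.trans_lt hμρ).ne' hμρ (fun D hD => by
      obtain ⟨α, hα, hαD, hl⟩ := hM.exists_hasLadder_mem_club hreg hcor hμρ' hlim hD
      exact ⟨α, hα, hαD, hα, hl⟩) (fun α hα => hF α hα.1 hα.2)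
  have hP := hM.pw (hM.toZFSet ρ.ord)
  -- `G` tests stationarity only against clubs in `M`. Truly stationary sets pass this test, so `G`
  -- is unbounded.
  refine ⟨c, _, hc, hM.sep ![⟨_, hP⟩, hM.ord ρ.ord, ⟨_, hc⟩, hM.ord μ.ord, hM.ord ξ]
    (R := fun c => ∀ C ∈ c.1 0, IsClubIn (c.1 1) C → ∃ α ∈ C, ∃ f ∈ c.1 2,
      IsLadderSet f (c.1 3) α ∧ ZFSet.pair (c.1 4) c.top ∈ f)
    (.ball (.fv _) <| .imp (.isClubIn (.fv _) .top) <| .bex .top <| .bex (.fv _) <|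
      .and (.isLadderSet .top (.fv _) IsVar.top.pop) <|
        .pair_mem (.fv _) IsVar.top.pop.pop.pop .top) (hM.toZFSet ρ.ord),
    ZFSet.sep_subset, fun η hη => ?_, huniq, fun α hα hl => ⟨_, hFc α hα hl, hF α hα hl⟩, ξ, hξ,
    fun γ hγ => (ZFSet.mem_sep.1 hγ).2⟩
  obtain ⟨γ, hγ, hηγ, h⟩ := hG η hη
  refine ⟨γ, hηγ, ZFSet.mem_sep.2 ⟨Ordinal.toZFSet_mem_toZFSet_iff.2 hγ, ?_⟩⟩
  change ∀ C ∈ InnerModel.pw M ρ.ord.toZFSet, IsClubIn ρ.ord.toZFSet C → ∃ α ∈ C, ∃ f ∈ c,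
    IsLadderSet f μ.ord.toZFSet α ∧ ZFSet.pair ξ.toZFSet γ.toZFSet ∈ f
  intro C _ hC
  obtain ⟨α, hα, hαC, ⟨_, hl⟩, hαγ⟩ := h _ hC.isClubBelow
  exact ⟨_, hαC, _, hFc α hα hl, isLadderSet_iff.2 ⟨_, rfl, hF α hα hl⟩,
    pair_mem_ograph.2 ⟨hξ, hαγ.symm⟩⟩

/-! ### Recovering ordinals as values of the embedding -/

namespace IsElementary

variable {M N : Class.{u}} {j : Elem M → Elem N}

/-- The image of an unbounded set of values of a ladder system consists of values of the embedding:
a ladder of the image system at a closure point of the embedding is an image of a ladder. -/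
theorem exists_eq_ordMap (hM : IsTransitiveModel M) (hN : IsTransitiveModel N)
    (hj : IsElementary j) {θ : Ordinal.{u}}
    (hθM : ∀ δ, IsRegularIn M δ → θ.toZFSet ∈ δ → StationaryCorrectAt M δ)
    (hθN : ∀ δ, IsRegularIn N δ → θ.toZFSet ∈ δ → StationaryCorrectAt N δ)
    {μ ρ : Cardinal.{u}} (hμ : μ.IsRegular) (hρ : ρ.IsRegular) (hμρ : μ < ρ) (hθμ : θ < μ.ord)
    (hjμ : ordMap hM j μ.ord = μ.ord) (hjρ : ordMap hM j ρ.ord = ρ.ord)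
    {c G : Elem M} {ξ : Ordinal.{u}} (hξ : ξ < μ.ord)
    (huniq : ∀ f ∈ c.val, ∀ g ∈ c.val, ∀ α ∈ ρ.ord.toZFSet,
      IsLadderSet f μ.ord.toZFSet α → IsLadderSet g μ.ord.toZFSet α → f = g)
    (hsys : ∀ α < ρ.ord, HasLadder M μ.ord α → ∃ h, ograph μ.ord h ∈ c.val ∧ IsLadder h μ.ord α)
    (hG : ∀ γ ∈ G.val, ∀ C ∈ pw M ρ.ord.toZFSet, IsClubIn ρ.ord.toZFSet C →
      ∃ α ∈ C, ∃ f ∈ c.val, IsLadderSet f μ.ord.toZFSet α ∧ ZFSet.pair ξ.toZFSet γ ∈ f)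
    {γ : ZFSet.{u}} (hγ : γ ∈ (j G).val) : ∃ a, γ = (ordMap hM j a).toZFSet := by
  have hmono := hj.ordMap_strictMono hM hN
  have hjμ' : (j (hM.ord μ.ord)).val = μ.ord.toZFSet := by rw [hj.map_ord hM hN, hjμ]
  have hjρ' : (j (hM.ord ρ.ord)).val = ρ.ord.toZFSet := by rw [hj.map_ord hM hN, hjρ]
  have hjξ := hj.map_ord hM hN ξ
  have hjG : ∀ g ∈ (j G).val, ∀ C ∈ (j ⟨_, hM.pw (hM.ord ρ.ord).2⟩).val,
      IsClubIn (j (hM.ord ρ.ord)).val C → ∃ α ∈ C, ∃ f ∈ (j c).val,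
        IsLadderSet f (j (hM.ord μ.ord)).val α ∧ ZFSet.pair (j (hM.ord ξ)).val g ∈ f :=
    (hj.iff hM hN (R := fun c => ∀ g ∈ c.1 0, ∀ C ∈ c.1 1, IsClubIn (c.1 2) C → ∃ α ∈ C,
        ∃ f ∈ c.1 3, IsLadderSet f (c.1 4) α ∧ ZFSet.pair (c.1 5) g ∈ f)
      (.ball (.fv _) <| .ball (.fv _) <| .imp (.isClubIn (.fv _) .top) <| .bex .top <|
        .bex (.fv _) <| .and (.isLadderSet .top (.fv _) IsVar.top.pop) <|
          .pair_mem (.fv _) IsVar.top.pop.pop.pop .top)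
      ![G, ⟨_, hM.pw (hM.ord ρ.ord).2⟩, hM.ord ρ.ord, c, hM.ord μ.ord, hM.ord ξ]).2 hG
  have hjuniq : ∀ f ∈ (j c).val, ∀ g ∈ (j c).val, ∀ α ∈ (j (hM.ord ρ.ord)).val,
      IsLadderSet f (j (hM.ord μ.ord)).val α → IsLadderSet g (j (hM.ord μ.ord)).val α → f = g :=
    (hj.iff hM hN (R := fun c => ∀ f ∈ c.1 0, ∀ g ∈ c.1 0, ∀ α ∈ c.1 1,
        IsLadderSet f (c.1 2) α → IsLadderSet g (c.1 2) α → f = g)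
      (.ball (.fv _) <| .ball (.fv _) <| .ball (.fv _) <|
        .imp (.isLadderSet IsVar.top.pop.pop (.fv _) .top) <|
        .imp (.isLadderSet IsVar.top.pop (.fv _) .top) <| .eq IsVar.top.pop.pop IsVar.top.pop)
      ![c, hM.ord ρ.ord, hM.ord μ.ord]).2 huniq
  rw [hjμ', hjρ'] at hjuniq
  rw [hjμ', hjρ', hjξ] at hjG
  have hρN := hN.toZFSet ρ.ord
  -- The points whose ladder in `j c` has value `γ` at `j ξ` are stationary in `N` by elementarity,
  -- hence in `V` by correctness of `N`.
  have hT := hN.sep ![j c, hN.ord μ.ord, hN.ord (ordMap hM j ξ),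
      ⟨γ, hN.mem_trans hγ (j G).2⟩]
    (R := fun c => ∃ f ∈ c.1 0, IsLadderSet f (c.1 1) c.top ∧ ZFSet.pair (c.1 2) (c.1 3) ∈ f)
    (.bex (.fv _) <| .and (.isLadderSet .top (.fv _) IsVar.top.pop) <|
      .pair_mem (.fv _) (.fv _) .top) hρN
  set T := ZFSet.sep (fun α => ∃ f ∈ (j c).val, IsLadderSet f μ.ord.toZFSet α ∧
    ZFSet.pair (ordMap hM j ξ).toZFSet γ ∈ f) ρ.ord.toZFSet with hTdef
  have hTst : IsStationaryIn N ρ.ord.toZFSet T := by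
    refine ⟨ZFSet.sep_subset, fun C hC hCc => ?_⟩
    obtain ⟨α, hαC, h⟩ := hjG γ hγ C (hj.mem_map_pw hM hN _ hC (by rw [hjρ']; exact hCc.1)) hCc
    exact ⟨α, ZFSet.mem_sep.2 ⟨hCc.1 hαC, h⟩, hαC⟩
  have hθρ : θ < ρ.ord := hθμ.trans (Cardinal.ord_lt_ord.2 hμρ)
  obtain ⟨α, hα, hαD, hαT⟩ := (hθN _ (hN.isRegularIn_ord hρ)
    (Ordinal.toZFSet_mem_toZFSet_iff.2 hθρ) T hT hTst).exists_mem
    (isClubBelow_closurePoints hρ (hμ.aleph0_le.trans_lt hμρ).ne' (s := ordMap hM j)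
      fun i hi => (hmono hi).trans_eq hjρ)
  obtain ⟨_, f, hf, hfl, hp⟩ := ZFSet.mem_sep.1 hαT
  obtain ⟨_, _, hl⟩ := isLadderSet_iff.1 hfl
  -- The ladder in `N` shows that `α` has cofinality `μ`, so correctness of `M` yields a ladder in
  -- `M`, and the closure point `α` is fixed.
  have hαM := hM.hasLadder_of_cof_eq hθM hμ hθμ (hl.cof_eq.trans hμ.cof_ord)
  have hjα := hj.ordMap_eq_of_hasLadder hM hN hjμ hαD.2 hαM
  obtain ⟨h, hh, hhl⟩ := hsys α hα hαM
  have hhM := hM.mem_trans hh c.2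
  have hjh := hj.isLadderSet_map hM hN (f := ⟨_, hhM⟩) (isLadderSet_iff.2 ⟨h, rfl, hhl⟩)
  rw [hjμ, hjα] at hjh
  -- As `j α = α`, uniqueness in the image system identifies `f` with the image of the ladder of `c`
  -- at `α`.
  have hfj := hjuniq f hf _ ((hj.mem_iff hM hN ⟨_, hhM⟩ c).2 hh) _
    (Ordinal.toZFSet_mem_toZFSet_iff.2 hα) hfl hjh
  obtain ⟨h', hh', _⟩ := isLadderSet_iff.1 hfl
  have hp' := hj.ord_pair_mem hM hN (f := ⟨_, hhM⟩) (pair_mem_ograph.2 ⟨hξ, rfl⟩)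
  rw [← hfj, hh', toZFSet_pair_mem_graph] at hp'
  rw [hh', toZFSet_pair_mem_graph] at hp
  exact ⟨h ξ, hp.2.trans hp'.2.symm⟩

/-- If the image of an unbounded set of ordinals of the model consists of values of the embedding,
then so does the whole cardinal. -/
theorem exists_ordMap_eq (hM : IsTransitiveModel M) (hN : IsTransitiveModel N)
    (hj : IsElementary j) {ρ : Cardinal.{u}} (hρ : ρ.IsRegular) {G : Elem M}
    (hGρ : G.val ⊆ ρ.ord.toZFSet) (hGu : ∀ η < ρ.ord, ∃ γ, η < γ ∧ γ.toZFSet ∈ G.val)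
    (hjG : ∀ γ ∈ (j G).val, ∃ a, γ = (ordMap hM j a).toZFSet) {κ : Ordinal.{u}} (hκ : κ < ρ.ord) :
    ∃ β, ordMap hM j β = κ := by
  have hmono := hj.ordMap_strictMono hM hN
  obtain ⟨σ, h, hh, hs, hG⟩ := hM.exists_strictMono_enum G.2 fun z hz => by
    obtain ⟨a, _, rfl⟩ := Ordinal.mem_toZFSet_iff.1 (hGρ hz)
    exact ZFSet.isOrdinal_toZFSet a
  -- An unbounded subset of `ρ` has order type at least `ρ`, so `κ < σ ≤ j σ` is an index of the
  -- image enumeration.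
  have hσ : ρ.ord ≤ σ := by
    by_contra! hlt
    obtain ⟨η, hη, hb⟩ := exists_bound_of_card_lt_cof (ν := ρ.ord)
      (by rw [hρ.cof_ord]; exact Cardinal.lt_ord.1 hlt) (f := h) fun i hi =>
        Ordinal.toZFSet_mem_toZFSet_iff.1 (hGρ ((hG _).2 ⟨i, hi, rfl⟩))
    obtain ⟨γ, hηγ, hγ⟩ := hGu η hη
    obtain ⟨i, hi, rfl⟩ := (hG γ).1 hγ
    exact (hb i hi).not_gt hηγ
  have htot : ∀ i ∈ (j (hM.ord σ)).val, ∃ g ∈ (j G).val, ZFSet.pair i g ∈ (j ⟨_, hh⟩).val :=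
    (hj.iff hM hN (R := fun c => ∀ i ∈ c.1 0, ∃ g ∈ c.1 1, ZFSet.pair i g ∈ c.1 2)
      (.ball (.fv _) <| .bex (.fv _) <| .pair_mem IsVar.top.pop .top (.fv _))
      ![hM.ord σ, G, ⟨_, hh⟩]).2 (forall_mem_toZFSet.2 fun i hi =>
        ⟨_, (hG _).2 ⟨i, hi, rfl⟩, pair_mem_ograph.2 ⟨hi, rfl⟩⟩)
  have hinj' : ∀ i ∈ σ.toZFSet, ∀ k ∈ σ.toZFSet, ∀ g ∈ G.val,
      ZFSet.pair i g ∈ ograph σ h → ZFSet.pair k g ∈ ograph σ h → i = k := by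
    refine forall_mem_toZFSet.2 fun i hi => forall_mem_toZFSet.2 fun k hk g _ h1 h2 => ?_
    have := (toZFSet_pair_mem_graph.1 h1).2.symm.trans (toZFSet_pair_mem_graph.1 h2).2
    rw [hs.injOn hi hk (Ordinal.toZFSet_injective this)]
  have hinj : ∀ i ∈ (j (hM.ord σ)).val, ∀ k ∈ (j (hM.ord σ)).val, ∀ g ∈ (j G).val,
      ZFSet.pair i g ∈ (j ⟨_, hh⟩).val → ZFSet.pair k g ∈ (j ⟨_, hh⟩).val → i = k :=
    (hj.iff hM hN (R := fun c => ∀ i ∈ c.1 0, ∀ k ∈ c.1 0, ∀ g ∈ c.1 1,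
        ZFSet.pair i g ∈ c.1 2 → ZFSet.pair k g ∈ c.1 2 → i = k)
      (.ball (.fv _) <| .ball (.fv _) <| .ball (.fv _) <|
        .imp (.pair_mem IsVar.top.pop.pop .top (.fv _)) <|
        .imp (.pair_mem IsVar.top.pop .top (.fv _)) <| .eq IsVar.top.pop.pop IsVar.top.pop)
      ![hM.ord σ, G, ⟨_, hh⟩]).2 hinj'
  rw [hj.map_ord hM hN] at htot hinj
  have hκσ : κ.toZFSet ∈ (ordMap hM j σ).toZFSet :=
    Ordinal.toZFSet_mem_toZFSet_iff.2 ((hκ.trans_le hσ).trans_le hmono.le_apply)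
  -- The image enumeration takes at `κ` a value `j a` with `a = h β` in `G`. It also takes this
  -- value at `j β`, so `κ = j β` by injectivity.
  obtain ⟨g, hg, hp⟩ := htot _ hκσ
  obtain ⟨a, rfl⟩ := hjG g hg
  have hg' := hg
  rw [← hj.map_ord hM hN] at hg'
  obtain ⟨β, hβ, rfl⟩ := (hG a).1 ((hj.mem_iff hM hN _ _).1 hg')
  refine ⟨β, Ordinal.toZFSet_injective ?_⟩
  exact hinj _ (Ordinal.toZFSet_mem_toZFSet_iff.2 (hmono hβ)) _ hκσ _ hg
    (hj.ord_pair_mem hM hN (pair_mem_ograph.2 ⟨hβ, rfl⟩)) hp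

end IsElementary

end InnerModel

theorem theorem4p1 (M N : Class.{u})
    (hM : InnerModel.IsTransitiveModel M) (hN : InnerModel.IsTransitiveModel N)
    (hMs : InnerModel.EventuallyStationaryCorrect M)
    (hNs : InnerModel.EventuallyStationaryCorrect N) :
    ¬ ∃ j : InnerModel.Elem M → InnerModel.Elem N,
      InnerModel.IsElementary j ∧ ¬ InnerModel.IsTrivial j := by
  rintro ⟨j, hj, hnt⟩
  obtain ⟨θM, hθM⟩ := hMs
  obtain ⟨θN, hθN⟩ := hNs
  have hmono := hj.ordMap_strictMono hM hN
  have key : ∀ {θ θ' : Ordinal.{u}} {δ : ZFSet.{u}}, θ ≤ θ' → θ'.toZFSet ∈ δ → δ.IsOrdinal →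
      θ.toZFSet ∈ δ := by
    intro θ θ' δ hle hθ hδ
    rw [← hδ.toZFSet_rank_eq] at hθ ⊢
    rw [Ordinal.toZFSet_mem_toZFSet_iff] at hθ ⊢
    exact hle.trans_lt hθ
  replace hθM : ∀ δ, InnerModel.IsRegularIn M δ → (max θM θN).toZFSet ∈ δ → InnerModel.StationaryCorrectAt M δ :=
    fun δ hδ hθ => hθM δ hδ (key (le_max_left _ _) hθ hδ.2.1)
  replace hθN : ∀ δ, InnerModel.IsRegularIn N δ → (max θM θN).toZFSet ∈ δ → InnerModel.StationaryCorrectAt N δ :=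
    fun δ hδ hθ => hθN δ hδ (key (le_max_right _ _) hθ hδ.2.1)
  generalize max θM θN = θ at hθM hθN
  have hreg : ∀ {l : Ordinal.{u}}, Ordinal.omega0 < l → (Order.succ l.card).IsRegular :=
    fun hl => Cardinal.isRegular_succ <| by
      rw [← Ordinal.card_omega0]
      exact Ordinal.card_le_card hl.le
  have hlt : ∀ l : Ordinal.{u}, l < (Order.succ l.card).ord :=
    fun l => Cardinal.lt_ord.2 (Order.lt_succ _)
  refine hnt (hj.isTrivial_of_ordMap_eq hM hN fun κ => ?_)
  induction κ using WellFoundedLT.induction with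
  | _ κ ih =>
  -- The successor cardinals of `l` and `m` serve as `μ` and `ρ`.
  obtain ⟨l, hl, hjl, hll, hlc⟩ := hj.exists_fixed_limitCard hM hN hθM
    (max θ Ordinal.omega0)
  obtain ⟨hθl, hωl⟩ := max_lt_iff.1 hl
  obtain ⟨m, hm, hjm, hml, hmc⟩ := hj.exists_fixed_limitCard hM hN hθM
    (max κ (Order.succ l.card).ord)
  obtain ⟨hκm, hlm⟩ := max_lt_iff.1 hm
  have hωm := hωl.trans ((hlt l).trans hlm)
  have hμρ : Order.succ l.card < Order.succ m.card := Cardinal.ord_lt_ord.1 (hlm.trans (hlt m))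
  obtain ⟨c, G, hc, hG, hGρ, hGu, huniq, hsys, ξ, hξ, h⟩ :=
    hM.exists_ladder_system_coordinate hθM (hreg hωl) (hreg hωm) hμρ
      (hθl.trans ((hlt l).trans (hlm.trans (hlt m))))
  obtain ⟨β, hβ⟩ := hj.exists_ordMap_eq hM hN (hreg hωm) (G := ⟨G, hG⟩) hGρ hGu
    (fun γ hγ => hj.exists_eq_ordMap hM hN hθM hθN (hreg hωl) (hreg hωm) hμρ (hθl.trans (hlt l))
      (hj.ordMap_succ_eq hM hN hθM hll hωl hlc hθl hjl)
      (hj.ordMap_succ_eq hM hN hθM hml hωm hmc (hθl.trans ((hlt l).trans hlm)) hjm)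
      (c := ⟨c, hc⟩) hξ huniq hsys h hγ) (hκm.trans (hlt m))
  -- From `κ = j β` follows `β ≤ κ`, and a smaller `β` would be fixed by induction.
  rcases (hβ ▸ hmono.le_apply : β ≤ κ).lt_or_eq with hlt | rfl
  · exact absurd (ih β hlt ▸ hβ : β = κ) hlt.ne
  · exact hβ
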